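/- Let $d\ge 1$, $\alpha\in\mathbb R$. The sample space is $\mathcal H_s=\mathbb C^d$ with canonical basis $e_0,\dots,e_{d-1}$, the reservoir space is $\mathcal H_r=\ell^2(\mathbb Z)$ with canonical basis $(\Psi_j)_{j\in\mathbb Z}$. Let $a^{\#}_j=a^{\#}(e_j)$, $b^{\#}_j=b^{\#}(\Psi_j)$ be the fermionic creation and annihilation operators on the antisymmetric Fock spaces $\mathcal F_-(\mathcal H_s)$, $\mathcal F_-(\mathcal H_r)$, and let $\mathcal A$, $\mathcal B$ be the $C^*$-algebras that they generate. Let $S\Psi_j=\Psi_{j-1}$ be the shift on $\mathcal H_r$ and $S_pe_j=e_{j-1}$, $S_pe_0=e_{d-1}$ the periodic shift on $\mathcal H_s$, with second quantizations $\Gamma(S)$, $\Gamma(S_p)$. On $\mathcal F_-(\mathcal H_r)\otimes\mathcal F_-(\mathcal H_s)$ put $$U=(\Gamma(S)\otimes\Gamma(S_p))\,K,\qquad K=\exp[-i\alpha(b_0^*\otimes a_0+b_0\otimes a_0^*)],\qquad \tau^t(M)=U^{*t}MU^t\quad (M\in\mathcal B\otimes\mathcal A).$$ Let $\Sigma$ be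 an operator on $\ell^2(\mathbb Z)$ with $0\le\Sigma\le 1$ and $[\Sigma,S]=0$, so that $\langle\Psi_j,\Sigma\Psi_k\rangle=\sigma(k-j)$ for a function $\sigma:\mathbb Z\to\mathbb C$, and let $\omega_\Sigma$ be the gauge-invariant quasi-free state on $\mathcal B$ with density $\Sigma$: $\omega_\Sigma(b^*(\varphi_m)\cdots b^*(\varphi_1)b(\psi_1)\cdots b(\psi_n))=\delta_{nm}\det(\langle\psi_j,\Sigma\varphi_k\rangle)$. Let $\rho$ be any density matrix on $\mathcal F_-(\mathcal H_s)$. Let $\rho^{(1)}$ and $\rho^{(1)}_m$ ($m\in\mathbb N=\{0,1,2,\dots\}$) be the one-body reduced density matrices of the sample at times $0$ and $md$, i.e. the $d\times d$ matrices with entries $$\langle e_j,\rho^{(1)}e_k\rangle=\operatorname{tr}(\rho\,a_k^*a_j),\qquad \langle e_j,\rho^{(1)}_me_k\rangle=(\omega_\Sigma\otimes\rho)\big(\tau^{md}(\mathbb 1\otimes a_k^*a_j)\big),$$ and for $u\in\mathbb Z$ let $\sigma^{(u)}$ be the $d\times d$ matrix with entries $\sigma^{(u)}_{jk}=\sigma(k-j+ud)$,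 $0\le j,k\le d-1$. Set $$B(m)=\sigma^{(0)}+\sum_{u=1}^{m}\cos^u(\alpha)\,(\sigma^{(u)}+\sigma^{(-u)}).$$ Then for all $m\in\mathbb N$ $$\rho^{(1)}_m=\cos^{2m}(\alpha)\,\rho^{(1)}+(1-\cos^{2m}(\alpha))\,\sigma^{(0)}+\sum_{u=1}^{m-1}\big(\cos^u(\alpha)-\cos^{2m-u}(\alpha)\big)(\sigma^{(u)}+\sigma^{(-u)}),$$ $$\rho^{(1)}_{m+1}=\cos^2(\alpha)\,\rho^{(1)}_m+\sin^2(\alpha)\,B(m).$$ Moreover, if $\alpha\notin\pi\mathbb Z$, then $\rho^{(1)}_\infty=\lim_{m\to\infty}\rho^{(1)}_m$ exists and $$\rho^{(1)}_\infty=\lim_{m\to\infty}B(m)=\sigma^{(0)}+\sum_{u=1}^{\infty}\cos^u(\alpha)\,(\sigma^{(u)}+\sigma^{(-u)}),$$ where the series converges absolutely. -/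

import Mathlib

open scoped ComplexConjugate

noncomputable section

namespace RepeatedInteraction

/-- The Hilbert space `ℓ²(ι)`. -/
abbrev L2 (ι : Type) : Type := lp (fun _ : ι => ℂ) 2

/-- The canonical basis vector `e_i` of `ℓ²(ι)`. -/
def basisVec {ι : Type} [DecidableEq ι] (i : ι) : L2 ι := lp.single 2 i (1 : ℂ)

/-- The antisymmetric Fock space over `ℓ²(ι)` in occupation numbers: `basisVec X`, for
`X = {i₁ < … < i_p}`, is the unit vector `e_{i₁} ∧ … ∧ e_{i_p}`, and `basisVec ∅` is the vacuum. -/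
abbrev Fock (ι : Type) : Type := L2 (Finset ι)

theorem basisVec_apply {ι : Type} [DecidableEq ι] (i j : ι) :
    basisVec i j = if j = i then 1 else 0 := by
  rw [basisVec, lp.coeFn_single, Pi.single_apply]

theorem inner_basisVec_left {ι : Type} [DecidableEq ι] (i : ι) (f : L2 ι) :
    inner ℂ (basisVec i) f = f i := by
  simp [basisVec, lp.inner_single_left]

theorem basisVec_orthonormal {ι : Type} [DecidableEq ι] :
    Orthonormal ℂ (basisVec : ι → L2 ι) := by
  rw [orthonormal_iff_ite]
  intro i j
  rw [inner_basisVec_left, basisVec_apply]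

theorem sum_weightedComp_le {κ : Type} (g : κ → κ) (s : κ → ℂ) (hs : ∀ X, ‖s X‖ ≤ 1)
    (hg : Set.InjOn g {X | s X ≠ 0}) (ψ : L2 κ) (t : Finset κ) :
    ∑ X ∈ t, ‖s X * ψ (g X)‖ ^ 2 ≤ ‖ψ‖ ^ 2 := by
  classical
  have h1 : ∑ X ∈ t, ‖s X * ψ (g X)‖ ^ 2 ≤ ∑ X ∈ t.filter (fun X => s X ≠ 0), ‖ψ (g X)‖ ^ 2 := by
    rw [Finset.sum_filter]
    refine Finset.sum_le_sum fun X _ => ?_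
    split_ifs with h
    · rw [norm_mul]
      gcongr
      exact mul_le_of_le_one_left (norm_nonneg _) (hs X)
    · simp only [ne_eq, not_not] at h
      simp [h]
  refine h1.trans ?_
  have h2 : ∑ X ∈ t.filter (fun X => s X ≠ 0), ‖ψ (g X)‖ ^ 2
      = ∑ Y ∈ (t.filter (fun X => s X ≠ 0)).image g, ‖ψ Y‖ ^ 2 := by
    rw [Finset.sum_image]
    intro x hx y hy h
    exact hg (Finset.mem_filter.1 hx).2 (Finset.mem_filter.1 hy).2 h
  rw [h2]
  have := lp.sum_rpow_le_norm_rpow (p := 2) (E := fun _ : κ => ℂ) (by norm_num) ψ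
    ((t.filter (fun X => s X ≠ 0)).image g)
  simpa using this

/-- The bounded operator `(T ψ)(X) = s(X) ψ(g X)` on `ℓ²(κ)`, for `|s| ≤ 1` and `g` injective on
the support of `s`. -/
def weightedComp {κ : Type} (g : κ → κ) (s : κ → ℂ) (hs : ∀ X, ‖s X‖ ≤ 1)
    (hg : Set.InjOn g {X | s X ≠ 0}) : L2 κ →L[ℂ] L2 κ :=
  LinearMap.mkContinuous
    { toFun := fun ψ => ⟨fun X => s X * ψ (g X), memℓp_gen' (C := ‖ψ‖ ^ 2) fun t => by
        simpa using sum_weightedComp_le g s hs hg ψ t⟩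
      map_add' := fun ψ χ => by
        ext X
        exact mul_add _ _ _
      map_smul' := fun c ψ => by
        ext X
        simp [mul_left_comm] } 1 fun ψ => by
    rw [one_mul]
    refine lp.norm_le_of_forall_sum_le (p := 2) (by norm_num) (norm_nonneg _) fun t => ?_
    simpa using sum_weightedComp_le g s hs hg ψ t

theorem weightedComp_apply {κ : Type} (g : κ → κ) (s : κ → ℂ) (hs : ∀ X, ‖s X‖ ≤ 1)
    (hg : Set.InjOn g {X | s X ≠ 0}) (ψ : L2 κ) (X : κ) :
    weightedComp g s hs hg ψ X = s X * ψ (g X) := rfl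

/-- `(-1)^{#{x ∈ X : x < i}}`: the sign of moving `e_i` past the smaller factors of `e_X`. -/
def fsign {ι : Type} [LinearOrder ι] (i : ι) (X : Finset ι) : ℂ :=
  (-1) ^ (X.filter (· < i)).card

theorem norm_fsign {ι : Type} [LinearOrder ι] (i : ι) (X : Finset ι) : ‖fsign i X‖ = 1 := by
  simp [fsign]

/-- The creation operator `c*(e_i)`, i.e. `e_X ↦ e_i ∧ e_X`, which is `0` for `i ∈ X` and
`fsign i X • e_{X ∪ {i}}` otherwise (`creatBasis_basisVec`). -/
def creatBasis {ι : Type} [LinearOrder ι] (i : ι) : Fock ι →L[ℂ] Fock ι :=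
  weightedComp (fun X => X.erase i) (fun X => if i ∈ X then fsign i X else 0)
    (fun X => by split_ifs <;> simp [norm_fsign])
    (fun X hX Y hY h => by
      have hX' : i ∈ X := by by_contra h; simp [h] at hX
      have hY' : i ∈ Y := by by_contra h; simp [h] at hY
      have h' : X.erase i = Y.erase i := h
      rw [← Finset.insert_erase hX', ← Finset.insert_erase hY', h'])

section
variable {ι : Type} [LinearOrder ι]

theorem creatBasis_apply (i : ι) (ψ : Fock ι) (X : Finset ι) :
    creatBasis i ψ X = (if i ∈ X then fsign i X else 0) * ψ (X.erase i) := rfl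

theorem fsign_erase (i : ι) (X : Finset ι) : fsign i (X.erase i) = fsign i X := by
  unfold fsign; congr 2; ext x; simp; intro h _; exact h.ne

theorem fsign_insert (i : ι) (X : Finset ι) : fsign i (insert i X) = fsign i X := by
  unfold fsign; rw [Finset.filter_insert, if_neg (lt_irrefl i)]

theorem creatBasis_basisVec (i : ι) (X : Finset ι) :
    creatBasis i (basisVec X) = if i ∈ X then 0 else fsign i X • basisVec (insert i X) := by
  ext Y
  rw [creatBasis_apply, basisVec_apply]
  by_cases hX : i ∈ X
  · have : Y.erase i ≠ X := by rintro rfl; simp at hX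
    simp [this, hX]
  · by_cases hY : i ∈ Y
    · by_cases h : Y.erase i = X
      · subst h
        simp [hY, Finset.insert_erase hY, basisVec_apply, fsign_erase]
      · have : Y ≠ insert i X := by
          rintro rfl; exact h (Finset.erase_insert hX)
        simp [basisVec_apply, this, h, hX]
    · have : Y ≠ insert i X := by
        rintro rfl; exact hY (Finset.mem_insert_self _ _)
      simp [basisVec_apply, this, hX, hY]

open ContinuousLinearMap in
theorem adjoint_creatBasis_apply (i : ι) (ψ : Fock ι) (X : Finset ι) :
    adjoint (creatBasis i) ψ X = if i ∈ X then 0 else fsign i X * ψ (insert i X) := by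
  rw [← inner_basisVec_left, adjoint_inner_right, creatBasis_basisVec]
  split_ifs with h
  · simp
  · rw [inner_smul_left, inner_basisVec_left]; simp [fsign]

theorem fsign_insert_lt {i j : ι} {X : Finset ι} (h : i < j) (hi : i ∉ X) :
    fsign j (insert i X) = - fsign j X := by
  unfold fsign
  rw [Finset.filter_insert, if_pos h, Finset.card_insert_of_notMem (by simp [hi]), pow_succ]
  simp

theorem fsign_insert_gt {i j : ι} {X : Finset ι} (h : j < i) :
    fsign j (insert i X) = fsign j X := by
  unfold fsign
  rw [Finset.filter_insert, if_neg h.not_gt]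

theorem fsign_swap {i j : ι} {X : Finset ι} (hij : i ≠ j) (hi : i ∉ X) (hj : j ∉ X) :
    fsign i X * fsign j (insert i X) = - (fsign j X * fsign i (insert j X)) := by
  rcases lt_or_gt_of_ne hij with h | h
  · rw [fsign_insert_lt h hi, fsign_insert_gt h]; ring
  · rw [fsign_insert_lt h hj, fsign_insert_gt h]; ring

theorem fsign_mul_self (i : ι) (X : Finset ι) : fsign i X * fsign i X = 1 := by
  unfold fsign; rw [← mul_pow]; simp

theorem creatBasis_anticomm (i j : ι) :
    creatBasis i * creatBasis j + creatBasis j * creatBasis i = (0 : Fock ι →L[ℂ] Fock ι) := by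
  ext ψ X
  change creatBasis i (creatBasis j ψ) X + creatBasis j (creatBasis i ψ) X = 0
  simp only [creatBasis_apply]
  rcases eq_or_ne i j with rfl | hij
  · simp
  · by_cases hi : i ∈ X <;> by_cases hj : j ∈ X <;> simp [hi, hj, hij, hij.symm]
    obtain ⟨Z, hZi, hZj, rfl⟩ : ∃ Z, i ∉ Z ∧ j ∉ Z ∧ X = insert i (insert j Z) := by
      refine ⟨(X.erase i).erase j, by simp, by simp, ?_⟩
      rw [Finset.insert_erase (by simp [hij.symm, hj]), Finset.insert_erase hi]
    have e1 : (insert i (insert j Z)).erase i = insert j Z :=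
      Finset.erase_insert (by simp [hij, hZi])
    have e2 : (insert i (insert j Z)).erase j = insert i Z := by
      rw [Finset.insert_comm]; exact Finset.erase_insert (by simp [hij.symm, hZj])
    rw [e1, e2, Finset.erase_insert hZj, Finset.erase_insert hZi, fsign_insert i,
      Finset.insert_comm, fsign_insert j (insert i Z), fsign_insert j Z, fsign_insert i Z]
    have := fsign_swap hij hZi hZj
    linear_combination (ψ Z) * this

open ContinuousLinearMap in
theorem creatBasis_car (i j : ι) :
    adjoint (creatBasis i) * creatBasis j + creatBasis j * adjoint (creatBasis i)
      = (if i = j then 1 else 0 : Fock ι →L[ℂ] Fock ι) := by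
  ext ψ X
  have : ((if i = j then 1 else 0 : Fock ι →L[ℂ] Fock ι) ψ) X = if i = j then ψ X else 0 := by
    split_ifs <;> rfl
  rw [this]
  change adjoint (creatBasis i) (creatBasis j ψ) X + creatBasis j (adjoint (creatBasis i) ψ) X = _
  simp only [creatBasis_apply, adjoint_creatBasis_apply]
  rcases eq_or_ne i j with rfl | hij
  · by_cases hi : i ∈ X
    · simp [hi, fsign_erase, Finset.insert_erase hi, ← mul_assoc, fsign_mul_self]
    · simp [hi, fsign_insert, Finset.erase_insert hi, ← mul_assoc, fsign_mul_self]
  · by_cases hi : i ∈ X <;> by_cases hj : j ∈ X <;> simp [hi, hj, hij, hij.symm]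
    obtain ⟨Z, hZj, rfl⟩ : ∃ Z, j ∉ Z ∧ X = insert j Z := 
      ⟨X.erase j, by simp, by rw [Finset.insert_erase hj]⟩
    have hZi : i ∉ Z := fun h => hi (by simp [h])
    have e2 : (insert i (insert j Z)).erase j = insert i Z := by
      rw [Finset.insert_comm]; exact Finset.erase_insert (by simp [hij.symm, hZj])
    rw [e2, Finset.erase_insert hZj, fsign_insert j, Finset.insert_comm, fsign_insert j]
    rcases lt_or_gt_of_ne hij with h | h
    · rw [fsign_insert_gt h, fsign_insert_lt h hZi]; ring
    · rw [fsign_insert_lt h hZj, fsign_insert_gt h]; ring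
end

section
variable {ι : Type} [LinearOrder ι]
open ContinuousLinearMap

theorem hasSum_congr' {κ E : Type} [AddCommMonoid E] [TopologicalSpace E] {f g : κ → E} {a : E}
    (h : ∀ i, f i = g i) : HasSum f a ↔ HasSum g a := by
  rw [funext h]

theorem norm_sq_sum_creatBasis_le (s : Finset ι) (φ : ι → ℂ) :
    ‖∑ i ∈ s, φ i • creatBasis i‖ ^ 2 ≤ ∑ i ∈ s, ‖φ i‖ ^ 2 := by
  set T : Fock ι →L[ℂ] Fock ι := ∑ i ∈ s, φ i • creatBasis i with hT
  have hT' : adjoint T = ∑ i ∈ s, conj (φ i) • adjoint (creatBasis i) := by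
    rw [hT, map_sum]
    exact Finset.sum_congr rfl fun i _ => LinearIsometryEquiv.map_smulₛₗ _ _ _
  have key : adjoint T * T + T * adjoint T = ((∑ i ∈ s, ‖φ i‖ ^ 2 : ℝ) : ℂ) • 1 := by
    have h1 : T * adjoint T
        = ∑ i ∈ s, ∑ j ∈ s, (conj (φ i) * φ j) • (creatBasis j * adjoint (creatBasis i)) := by
      rw [hT', hT, Finset.sum_mul_sum, Finset.sum_comm]
      refine Finset.sum_congr rfl fun i _ => Finset.sum_congr rfl fun j _ => ?_
      rw [smul_mul_smul_comm, mul_comm]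
    have h2 : adjoint T * T
        = ∑ i ∈ s, ∑ j ∈ s, (conj (φ i) * φ j) • (adjoint (creatBasis i) * creatBasis j) := by
      rw [hT', hT, Finset.sum_mul_sum]
      refine Finset.sum_congr rfl fun i _ => Finset.sum_congr rfl fun j _ => ?_
      rw [smul_mul_smul_comm]
    rw [h1, h2, ← Finset.sum_add_distrib, Complex.ofReal_sum, Finset.sum_smul]
    refine Finset.sum_congr rfl fun i hi => ?_
    rw [← Finset.sum_add_distrib]
    simp_rw [← smul_add, creatBasis_car, smul_ite, smul_zero]
    rw [Finset.sum_ite_eq, if_pos hi, Complex.conj_mul']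
    simp
  have hb : ‖T‖ ≤ Real.sqrt (∑ i ∈ s, ‖φ i‖ ^ 2) := by
    refine opNorm_le_bound _ (Real.sqrt_nonneg _) fun ψ => ?_
    have h3 : ‖T ψ‖ ^ 2 + ‖adjoint T ψ‖ ^ 2 = (∑ i ∈ s, ‖φ i‖ ^ 2) * ‖ψ‖ ^ 2 := by
      have := congrArg (fun R : Fock ι →L[ℂ] Fock ι => (inner ℂ ψ (R ψ) : ℂ)) key
      simp only [add_apply, inner_add_right, smul_apply, inner_smul_right] at this
      change inner ℂ ψ (adjoint T (T ψ)) + inner ℂ ψ (T (adjoint T ψ)) = _ * inner ℂ ψ ψ at this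
      rw [adjoint_inner_right, ← adjoint_inner_left T (adjoint T ψ) ψ,
        inner_self_eq_norm_sq_to_K, inner_self_eq_norm_sq_to_K, inner_self_eq_norm_sq_to_K] at this
      apply Complex.ofReal_injective
      push_cast
      rw [Complex.ofReal_sum] at this
      push_cast at this
      exact this
    have h4 : ‖T ψ‖ ^ 2 ≤ (∑ i ∈ s, ‖φ i‖ ^ 2) * ‖ψ‖ ^ 2 := by
      rw [← h3]; nlinarith [sq_nonneg ‖adjoint T ψ‖]
    calc ‖T ψ‖ = Real.sqrt (‖T ψ‖ ^ 2) := (Real.sqrt_sq (norm_nonneg _)).symm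
      _ ≤ Real.sqrt ((∑ i ∈ s, ‖φ i‖ ^ 2) * ‖ψ‖ ^ 2) := Real.sqrt_le_sqrt h4
      _ = _ := by rw [Real.sqrt_mul' _ (sq_nonneg _), Real.sqrt_sq (norm_nonneg _)]
  calc ‖T‖ ^ 2 ≤ Real.sqrt (∑ i ∈ s, ‖φ i‖ ^ 2) ^ 2 := by gcongr
    _ = _ := Real.sq_sqrt (Finset.sum_nonneg fun _ _ => sq_nonneg _)

theorem L2.hasSum_norm_sq {κ : Type} (φ : L2 κ) : HasSum (fun i => ‖φ i‖ ^ 2) (‖φ‖ ^ 2) := by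
  simpa using lp.hasSum_norm (p := 2) (E := fun _ : κ => ℂ) (by norm_num) φ

theorem summable_creat (φ : L2 ι) :
    Summable fun i => φ i • (creatBasis i : Fock ι →L[ℂ] Fock ι) := by
  rw [summable_iff_vanishing_norm]
  intro ε hε
  obtain ⟨s, hs⟩ := summable_iff_vanishing_norm.1 (L2.hasSum_norm_sq φ).summable (ε ^ 2)
    (by positivity)
  refine ⟨s, fun t ht => ?_⟩
  have h1 := hs t ht
  rw [Real.norm_of_nonneg (Finset.sum_nonneg fun _ _ => sq_nonneg _)] at h1
  exact lt_of_pow_lt_pow_left₀ 2 hε.le ((norm_sq_sum_creatBasis_le t φ).trans_lt h1)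

/-- The creation operator `c*(φ) = ∑_i φ_i c*(e_i)`, a norm-convergent sum (`summable_creat`). -/
def creat (φ : L2 ι) : Fock ι →L[ℂ] Fock ι := ∑' i, φ i • creatBasis i

/-- The annihilation operator `c(φ)`, the adjoint of `c*(φ)`. -/
def annih (φ : L2 ι) : Fock ι →L[ℂ] Fock ι := adjoint (creat φ)

theorem hasSum_creat (φ : L2 ι) : HasSum (fun i => φ i • creatBasis i) (creat φ) :=
  (summable_creat φ).hasSum

theorem hasSum_annih (φ : L2 ι) :
    HasSum (fun i => conj (φ i) • adjoint (creatBasis i)) (annih φ) := by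
  have := (hasSum_creat φ).map (adjoint (𝕜 := ℂ) (E := Fock ι) (F := Fock ι))
    (adjoint (𝕜 := ℂ) (E := Fock ι) (F := Fock ι)).continuous
  refine (hasSum_congr' fun i => ?_).1 this
  exact LinearIsometryEquiv.map_smulₛₗ _ _ _

theorem creat_basisVec (i : ι) : creat (basisVec i) = creatBasis i := by
  rw [creat, tsum_eq_single i]
  · simp [basisVec_apply]
  · intro j hj; simp [basisVec_apply, hj]

theorem creat_anticomm (φ χ : L2 ι) : creat φ * creat χ + creat χ * creat φ = 0 := by
  have h1 : ∀ j, creat φ * creatBasis j + creatBasis j * creat φ = 0 := fun j => by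
    have := ((hasSum_creat φ).mul_right (creatBasis j)).add
      ((hasSum_creat φ).mul_left (creatBasis j))
    refine this.unique ?_
    convert hasSum_zero using 2 with i
    rw [smul_mul_assoc, mul_smul_comm, ← smul_add, creatBasis_anticomm, smul_zero]
  have := ((hasSum_creat χ).mul_left (creat φ)).add ((hasSum_creat χ).mul_right (creat φ))
  refine this.unique ?_
  convert hasSum_zero using 2 with i
  rw [smul_mul_assoc, mul_smul_comm, ← smul_add, h1, smul_zero]

theorem annih_creat_car (φ χ : L2 ι) :
    annih φ * creat χ + creat χ * annih φ = (inner ℂ φ χ : ℂ) • 1 := by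
  have h1 : ∀ j, annih φ * creatBasis j + creatBasis j * annih φ = conj (φ j) • 1 := fun j => by
    have := ((hasSum_annih φ).mul_right (creatBasis j)).add
      ((hasSum_annih φ).mul_left (creatBasis j))
    refine this.unique ?_
    refine (hasSum_congr' fun i => ?_).2
      (hasSum_ite_eq j (conj (φ j) • (1 : Fock ι →L[ℂ] Fock ι)))
    rw [smul_mul_assoc, mul_smul_comm, ← smul_add, creatBasis_car]
    split_ifs with h
    · rw [h]
    · rw [smul_zero]
  have := ((hasSum_creat χ).mul_left (annih φ)).add ((hasSum_creat χ).mul_right (annih φ))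
  refine this.unique ?_
  have h2 := (lp.hasSum_inner (𝕜 := ℂ) φ χ).smul_const (1 : Fock ι →L[ℂ] Fock ι)
  refine (hasSum_congr' fun i => ?_).2 h2
  rw [smul_mul_assoc, mul_smul_comm, ← smul_add, h1, smul_smul]
  simp [RCLike.inner_apply]

/-- The vacuum vector. -/
def vac : Fock ι := basisVec ∅

theorem annih_vac (φ : L2 ι) : annih φ (vac : Fock ι) = 0 := by
  have h := (hasSum_annih φ).mapL (ContinuousLinearMap.apply ℂ (Fock ι) (vac : Fock ι))
  refine h.unique ?_
  convert hasSum_zero using 2 with i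
  have : adjoint (creatBasis i) (vac : Fock ι) = 0 := by
    ext X
    rw [adjoint_creatBasis_apply]
    simp [vac, basisVec_apply]
  simp [this]

/-- `u_{i₁} ∧ … ∧ u_{i_p} = c*(u_{i₁}) ⋯ c*(u_{i_p}) Ω` for `X = {i₁ < … < i_p}`. -/
def wedge (u : ι → L2 ι) (X : Finset ι) : Fock ι :=
  (X.sort.map fun i => creat (u i)).prod vac

theorem wedge_empty (u : ι → L2 ι) : wedge u ∅ = vac := by simp [wedge]

theorem wedge_insert (u : ι → L2 ι) {a : ι} {s : Finset ι} (h : ∀ x ∈ s, a < x) :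
    wedge u (insert a s) = creat (u a) (wedge u s) := by
  have ha : a ∉ s := fun h' => lt_irrefl _ (h a h')
  rw [wedge, Finset.sort_insert _ (fun b hb => (h b hb).le) ha]
  simp [wedge]

theorem fsign_of_lt {a : ι} {s : Finset ι} (h : ∀ x ∈ s, a < x) : fsign a s = 1 := by
  rw [fsign, Finset.filter_false_of_mem fun x hx => (h x hx).not_gt]; simp

theorem creat_creat_apply (φ χ : L2 ι) (ψ : Fock ι) :
    creat φ (creat χ ψ) = - creat χ (creat φ ψ) := by
  have := congrArg (fun T : Fock ι →L[ℂ] Fock ι => T ψ) (creat_anticomm φ χ)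
  exact eq_neg_of_add_eq_zero_left this

theorem annih_creat_apply (φ χ : L2 ι) (ψ : Fock ι) :
    annih φ (creat χ ψ) = (inner ℂ φ χ : ℂ) • ψ - creat χ (annih φ ψ) := by
  have := congrArg (fun T : Fock ι →L[ℂ] Fock ι => T ψ) (annih_creat_car φ χ)
  exact eq_sub_of_add_eq this

theorem creat_wedge (u : ι → L2 ι) (i : ι) (X : Finset ι) :
    creat (u i) (wedge u X) = if i ∈ X then 0 else fsign i X • wedge u (insert i X) := by
  induction X using Finset.induction_on_min with
  | empty =>
    rw [wedge_insert u (by simp)]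
    simp [fsign]
  | insert a s h ih =>
    have ha : a ∉ s := fun h' => lt_irrefl _ (h a h')
    rw [wedge_insert u h]
    rcases lt_trichotomy i a with hia | rfl | hia
    · have hi : ∀ x ∈ insert a s, i < x := by
        intro x hx
        rcases Finset.mem_insert.1 hx with rfl | hx
        · exact hia
        · exact hia.trans (h x hx)
      have hi' : i ∉ insert a s := fun h' => lt_irrefl _ (hi i h')
      rw [if_neg hi', fsign_of_lt hi, one_smul, wedge_insert u hi, wedge_insert u h]
    · rw [if_pos (Finset.mem_insert_self _ _)]
      have := creat_creat_apply (u i) (u i) (wedge u s)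
      have h2 : (2 : ℂ) • creat (u i) (creat (u i) (wedge u s)) = 0 := by
        rw [two_smul]; nth_rewrite 2 [this]; exact add_neg_cancel _
      exact (smul_eq_zero.1 h2).resolve_left two_ne_zero
    · rw [creat_creat_apply, ih]
      by_cases his : i ∈ s
      · simp [his]
      · have h' : ∀ x ∈ insert i s, a < x := by
          intro x hx
          rcases Finset.mem_insert.1 hx with rfl | hx
          · exact hia
          · exact h x hx
        rw [if_neg his, if_neg (by simp [his, hia.ne']), Finset.insert_comm, wedge_insert u h',
          fsign_insert_lt hia ha, map_smul, neg_smul]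

theorem annih_wedge {u : ι → L2 ι} (hu : Orthonormal ℂ u) (i : ι) (X : Finset ι) :
    annih (u i) (wedge u X) = if i ∈ X then fsign i X • wedge u (X.erase i) else 0 := by
  induction X using Finset.induction_on_min with
  | empty => simp [wedge_empty, annih_vac]
  | insert a s h ih =>
    have ha : a ∉ s := fun h' => lt_irrefl _ (h a h')
    rw [wedge_insert u h, annih_creat_apply, ih, orthonormal_iff_ite.1 hu]
    rcases eq_or_ne i a with rfl | hia
    · rw [if_pos rfl, if_neg ha, if_pos (Finset.mem_insert_self _ _), Finset.erase_insert ha,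
        fsign_insert, fsign_of_lt h]
      simp
    · by_cases his : i ∈ s
      · have h' : ∀ x ∈ s.erase i, a < x := fun x hx => h x (Finset.mem_of_mem_erase hx)
        rw [if_neg hia, if_pos his, if_pos (by simp [his]), Finset.erase_insert_of_ne hia.symm,
          wedge_insert u h', fsign_insert_lt (h i his) ha, map_smul]
        simp
      · simp [his, hia]

theorem wedge_orthonormal {u : ι → L2 ι} (hu : Orthonormal ℂ u) : Orthonormal ℂ (wedge u) := by
  rw [orthonormal_iff_ite]
  intro X
  induction X using Finset.induction_on_min with
  | empty =>
    intro Y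
    induction Y using Finset.induction_on_min with
    | empty => rw [wedge_empty, vac, inner_basisVec_left, basisVec_apply]
    | insert b t h ih =>
      rw [wedge_insert u h, wedge_empty, ← adjoint_inner_left, ← annih, annih_vac, inner_zero_left,
        if_neg (Finset.insert_ne_empty _ _).symm]
  | insert a s h ih =>
    intro Y
    have ha : a ∉ s := fun h' => lt_irrefl _ (h a h')
    rw [wedge_insert u h, ← adjoint_inner_right, ← annih, annih_wedge hu]
    by_cases haY : a ∈ Y
    · rw [if_pos haY, inner_smul_right, ih]
      by_cases hs : s = Y.erase a
      · subst hs
        rw [← fsign_erase, fsign_of_lt h]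
        simp [Finset.insert_erase haY]
      · have : insert a s ≠ Y := by
          rintro rfl; exact hs (Finset.erase_insert ha).symm
        simp [hs, this]
    · have : insert a s ≠ Y := by
        rintro rfl; exact haY (Finset.mem_insert_self _ _)
      simp [haY, this]

/-- The isometry `ℓ²(κ) → E` that maps the canonical basis to the orthonormal family `v`. -/
def isometryOfOrthonormal {κ E : Type} [NormedAddCommGroup E] [InnerProductSpace ℂ E]
    [CompleteSpace E] {v : κ → E} (hv : Orthonormal ℂ v) : L2 κ →ₗᵢ[ℂ] E :=
  hv.orthogonalFamily.linearIsometry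

theorem isometryOfOrthonormal_basisVec {κ E : Type} [DecidableEq κ] [NormedAddCommGroup E]
    [InnerProductSpace ℂ E] [CompleteSpace E] {v : κ → E} (hv : Orthonormal ℂ v) (k : κ) :
    isometryOfOrthonormal hv (basisVec k) = v k := by
  rw [isometryOfOrthonormal, basisVec, OrthogonalFamily.linearIsometry_apply_single]
  simp

/-- The second quantization `Γ(W)`, which maps `e_{i₁} ∧ … ∧ e_{i_p}` to
`W e_{i₁} ∧ … ∧ W e_{i_p}` (`secondQuant_basisVec`). -/
def secondQuant (W : L2 ι →ₗᵢ[ℂ] L2 ι) : Fock ι →ₗᵢ[ℂ] Fock ι :=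
  isometryOfOrthonormal (wedge_orthonormal (basisVec_orthonormal.comp_linearIsometry W))

theorem secondQuant_basisVec (W : L2 ι →ₗᵢ[ℂ] L2 ι) (X : Finset ι) :
    secondQuant W (basisVec X) = wedge (fun i => W (basisVec i)) X :=
  isometryOfOrthonormal_basisVec _ X

/-- The operator on `ℓ²(κ)` with `e_k ↦ e_{e k}`, for a bijection `e` of `κ`. -/
def permIso {κ : Type} [DecidableEq κ] (e : κ ≃ κ) : L2 κ →ₗᵢ[ℂ] L2 κ :=
  isometryOfOrthonormal (basisVec_orthonormal.comp e e.injective)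
end

section
variable {ι : Type} [LinearOrder ι]
open ContinuousLinearMap

theorem permIso_basisVec {κ : Type} [DecidableEq κ] (e : κ ≃ κ) (k : κ) :
    permIso e (basisVec k) = basisVec (e k) :=
  isometryOfOrthonormal_basisVec _ k

theorem ext_basisVec {κ E : Type} [DecidableEq κ] [NormedAddCommGroup E] [NormedSpace ℂ E]
    {T T' : L2 κ →L[ℂ] E} (h : ∀ k, T (basisVec k) = T' (basisVec k)) : T = T' := by
  ext ψ
  have hψ := lp.hasSum_single (E := fun _ : κ => ℂ) (p := 2) (by norm_num) ψ
  refine (hψ.mapL T).unique ((hasSum_congr' fun k => ?_).1 (hψ.mapL T'))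
  have : (lp.single 2 k (ψ k) : L2 κ) = ψ k • basisVec k := by
    rw [basisVec, ← lp.single_smul]; simp
  rw [this, map_smul, map_smul, h]

/-- The C*-algebra generated by the creation and annihilation operators on the Fock space. -/
def carAlgebra (ι : Type) [LinearOrder ι] : StarSubalgebra ℂ (Fock ι →L[ℂ] Fock ι) :=
  (StarAlgebra.adjoin ℂ (Set.range creat ∪ Set.range annih)).topologicalClosure

theorem creat_mem (φ : L2 ι) : creat φ ∈ carAlgebra ι :=
  StarSubalgebra.le_topologicalClosure _ (StarAlgebra.subset_adjoin _ _ (.inl ⟨φ, rfl⟩))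

theorem annih_mem (φ : L2 ι) : annih φ ∈ carAlgebra ι :=
  StarSubalgebra.le_topologicalClosure _ (StarAlgebra.subset_adjoin _ _ (.inr ⟨φ, rfl⟩))

theorem carAlgebra_isClosed : IsClosed (carAlgebra ι : Set (Fock ι →L[ℂ] Fock ι)) :=
  StarSubalgebra.isClosed_topologicalClosure _

theorem secondQuant_comp_creatBasis (W : L2 ι →ₗᵢ[ℂ] L2 ι) (i : ι) :
    creat (W (basisVec i)) * (secondQuant W).toContinuousLinearMap
      = (secondQuant W).toContinuousLinearMap * creatBasis i := by
  refine ext_basisVec fun X => ?_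
  change creat (W (basisVec i)) (secondQuant W (basisVec X))
    = secondQuant W (creatBasis i (basisVec X))
  rw [secondQuant_basisVec, creat_wedge (fun i => W (basisVec i)), creatBasis_basisVec]
  split_ifs
  · simp
  · rw [map_smul, secondQuant_basisVec]

theorem secondQuant_comp_annihBasis (W : L2 ι →ₗᵢ[ℂ] L2 ι) (i : ι) :
    annih (W (basisVec i)) * (secondQuant W).toContinuousLinearMap
      = (secondQuant W).toContinuousLinearMap * adjoint (creatBasis i) := by
  refine ext_basisVec fun X => ?_
  change annih (W (basisVec i)) (secondQuant W (basisVec X))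
    = secondQuant W (adjoint (creatBasis i) (basisVec X))
  have hb : wedge (basisVec : ι → L2 ι) = basisVec := by
    funext X
    induction X using Finset.induction_on_min with
    | empty => rw [wedge_empty, vac]
    | insert a s h ih =>
      have ha : a ∉ s := fun h' => lt_irrefl _ (h a h')
      rw [wedge_insert _ h, ih, creat_basisVec, creatBasis_basisVec, if_neg ha, fsign_of_lt h,
        one_smul]
  have h1 := annih_wedge (basisVec_orthonormal (ι := ι)) i X
  rw [hb, annih, creat_basisVec] at h1
  rw [secondQuant_basisVec, h1,
    annih_wedge (u := fun i => W (basisVec i)) (basisVec_orthonormal.comp_linearIsometry W) i X]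
  split_ifs
  · rw [map_smul, secondQuant_basisVec]
  · simp

theorem adjoint_mul_self_of_isometry {κ : Type} (V : L2 κ →ₗᵢ[ℂ] L2 κ) :
    adjoint V.toContinuousLinearMap * V.toContinuousLinearMap = 1 :=
  V.adjoint_comp_self

/-- The free evolution leaves the C*-algebra invariant. -/
theorem conj_mem_carAlgebra (e : ι ≃ ι) {x : Fock ι →L[ℂ] Fock ι} (hx : x ∈ carAlgebra ι) :
    adjoint (secondQuant (permIso e)).toContinuousLinearMap * x *
      (secondQuant (permIso e)).toContinuousLinearMap ∈ carAlgebra ι := by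
  set G := (secondQuant (permIso e)).toContinuousLinearMap with hG
  have hGG : adjoint G * G = 1 := adjoint_mul_self_of_isometry _
  let Q : Set (Fock ι →L[ℂ] Fock ι) :=
    {x | x * G = G * (adjoint G * x * G) ∧ adjoint G * x * G ∈ carAlgebra ι}
  have hQ : ∀ {x y}, y ∈ carAlgebra ι → x * G = G * y → x ∈ Q := by
    intro x y hy h
    have : adjoint G * x * G = y := by rw [mul_assoc, h, ← mul_assoc, hGG, one_mul]
    exact ⟨by rw [this, h], by rw [this]; exact hy⟩
  have hQc : IsClosed Q := by
    refine IsClosed.inter (isClosed_eq (by fun_prop) (by fun_prop)) ?_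
    exact carAlgebra_isClosed.preimage (f := fun x => adjoint G * x * G) (by fun_prop)
  have hQ0 : (0 : Fock ι →L[ℂ] Fock ι) ∈ Q := hQ (zero_mem _) (y := 0) (by simp)
  have hQadd : ∀ {x y}, x ∈ Q → y ∈ Q → x + y ∈ Q := fun {x y} hx hy =>
    hQ (add_mem hx.2 hy.2) (by rw [add_mul, mul_add, ← hx.1, ← hy.1])
  have hQmul : ∀ {x y}, x ∈ Q → y ∈ Q → x * y ∈ Q := fun {x y} hx hy =>
    hQ (mul_mem hx.2 hy.2) (by
      rw [← mul_assoc G, ← hx.1, mul_assoc x G, ← hy.1, mul_assoc])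
  have hQsmul : ∀ (c : ℂ) {x}, x ∈ Q → c • x ∈ Q := fun c {x} hx =>
    hQ (SMulMemClass.smul_mem c hx.2) (by rw [smul_mul_assoc, mul_smul_comm, ← hx.1])
  have hQsum : ∀ (s : Finset ι) (f : ι → Fock ι →L[ℂ] Fock ι), (∀ i, f i ∈ Q) →
      ∑ i ∈ s, f i ∈ Q := fun s f hf => by
    induction s using Finset.induction_on with
    | empty => simpa using hQ0
    | insert a s ha ih => rw [Finset.sum_insert ha]; exact hQadd (hf a) ih
  have hcB : ∀ i, creatBasis i ∈ Q := fun i => by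
    have h := secondQuant_comp_creatBasis (permIso e) (e.symm i)
    rw [permIso_basisVec, e.apply_symm_apply, creat_basisVec] at h
    refine hQ ?_ h
    rw [← creat_basisVec]; exact creat_mem _
  have haB : ∀ i, adjoint (creatBasis i) ∈ Q := fun i => by
    have h := secondQuant_comp_annihBasis (permIso e) (e.symm i)
    rw [permIso_basisVec, e.apply_symm_apply, annih, creat_basisVec] at h
    refine hQ ?_ h
    rw [← creat_basisVec]; exact annih_mem _
  have hc : ∀ φ, creat φ ∈ Q := fun φ =>
    hQc.mem_of_tendsto (hasSum_creat φ)
      (Filter.Eventually.of_forall fun s => hQsum s _ fun i => hQsmul _ (hcB i))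
  have ha : ∀ φ, annih φ ∈ Q := fun φ =>
    hQc.mem_of_tendsto (hasSum_annih φ)
      (Filter.Eventually.of_forall fun s => hQsum s _ fun i => hQsmul _ (haB i))
  have hadj : ∀ y ∈ StarAlgebra.adjoin ℂ (Set.range creat ∪ Set.range (annih (ι := ι))),
      y ∈ Q ∧ star y ∈ Q := by
    intro y hy
    induction hy using StarAlgebra.adjoin_induction with
    | mem y hy =>
      rcases hy with ⟨φ, rfl⟩ | ⟨φ, rfl⟩
      · exact ⟨hc φ, ha φ⟩
      · refine ⟨ha φ, ?_⟩
        have : star (annih φ) = creat φ := star_star (creat φ)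
        rw [this]; exact hc φ
    | algebraMap r =>
      have h1 : ∀ r : ℂ, algebraMap ℂ (Fock ι →L[ℂ] Fock ι) r ∈ Q := fun r =>
        hQ (algebraMap_mem _ r) (Algebra.commutes r G)
      refine ⟨h1 r, ?_⟩
      rw [← algebraMap_star_comm]; exact h1 _
    | add x y _ _ hx hy => exact ⟨hQadd hx.1 hy.1, by rw [star_add]; exact hQadd hx.2 hy.2⟩
    | mul x y _ _ hx hy => exact ⟨hQmul hx.1 hy.1, by rw [star_mul]; exact hQmul hy.2 hx.2⟩
    | star x _ hx => exact ⟨hx.2, by rw [star_star]; exact hx.1⟩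
  have : x ∈ Q := by
    have hx' : x ∈ closure (StarAlgebra.adjoin ℂ
        (Set.range creat ∪ Set.range (annih (ι := ι))) : Set (Fock ι →L[ℂ] Fock ι)) := hx
    exact hQc.closure_subset_iff.2 (fun y hy => (hadj y hy).1) hx'
  exact this.2

end

/-- The C*-algebra of bounded operators on `F_-(ℓ²(ℤ)) ⊗ F_-(ℂ^d)`, written as block matrices with
respect to the (finite) orthonormal basis `e_X`, `X ⊆ {0, …, d-1}`, of the second factor. -/
abbrev BlockOp (d : ℕ) : Type :=
  CStarMatrix (Finset (Fin d)) (Finset (Fin d)) (Fock ℤ →L[ℂ] Fock ℤ)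

/-- The operator `T ⊗ A`; its blocks are `⟨e_X, A e_Y⟩ T`. -/
def tensorOp {d : ℕ} (T : Fock ℤ →L[ℂ] Fock ℤ) (A : Fock (Fin d) →L[ℂ] Fock (Fin d)) :
    BlockOp d :=
  CStarMatrix.ofMatrix fun X Y => (inner ℂ (basisVec X) (A (basisVec Y)) : ℂ) • T

theorem tensorOp_apply {d : ℕ} (T : Fock ℤ →L[ℂ] Fock ℤ) (A : Fock (Fin d) →L[ℂ] Fock (Fin d))
    (X Y : Finset (Fin d)) :
    tensorOp T A X Y = (inner ℂ (basisVec X) (A (basisVec Y)) : ℂ) • T := rfl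

/-- The observable algebra `𝓑 ⊗ 𝓐`, where `𝓑` is the CAR algebra of the reservoir and `𝓐` that of
the sample; as `𝓐` is the full matrix algebra, these are the block matrices over `𝓑`. -/
def obsAlgebra (d : ℕ) : StarSubalgebra ℂ (BlockOp d) where
  carrier := {M | ∀ X Y, M X Y ∈ carAlgebra ℤ}
  mul_mem' := fun {M N} hM hN X Y => by
    rw [CStarMatrix.mul_apply]
    exact sum_mem fun Z _ => mul_mem (hM X Z) (hN Z Y)
  add_mem' := fun {M N} hM hN X Y => add_mem (hM X Y) (hN X Y)
  algebraMap_mem' := fun r X Y => by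
    rw [CStarMatrix.algebraMap_apply]
    split_ifs
    · exact algebraMap_mem _ r
    · exact zero_mem _
  star_mem' := fun {M} hM X Y => by
    rw [CStarMatrix.star_apply]
    exact star_mem (hM Y X)

theorem obsAlgebra_isClosed (d : ℕ) : IsClosed (obsAlgebra d : Set (BlockOp d)) := by
  have : (obsAlgebra d : Set (BlockOp d))
      = ⋂ X, ⋂ Y, (fun M : BlockOp d => M X Y) ⁻¹' (carAlgebra ℤ : Set _) := by
    ext M; simp only [Set.mem_iInter]; rfl
  rw [this]
  refine isClosed_iInter fun X => isClosed_iInter fun Y => carAlgebra_isClosed.preimage ?_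
  exact (continuous_apply Y).comp (continuous_apply X)

theorem tensorOp_mem {d : ℕ} {T : Fock ℤ →L[ℂ] Fock ℤ} (hT : T ∈ carAlgebra ℤ)
    (A : Fock (Fin d) →L[ℂ] Fock (Fin d)) : tensorOp T A ∈ obsAlgebra d := fun _ _ =>
  SMulMemClass.smul_mem _ hT

/-- The shift `S Ψ_j = Ψ_{j-1}` on the reservoir space `ℓ²(ℤ)`. -/
def resShift : L2 ℤ →ₗᵢ[ℂ] L2 ℤ := permIso (Equiv.subRight 1)

/-- The periodic shift `S_p e_j = e_{j-1}`, `S_p e_0 = e_{d-1}`, on `ℂ^d` (indices modulo `d`). -/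
def sampleShift (d : ℕ) [NeZero d] : L2 (Fin d) →ₗᵢ[ℂ] L2 (Fin d) := permIso (Equiv.subRight 1)

/-- The coupling `K = exp[-iα (b₀* ⊗ a₀ + b₀ ⊗ a₀*)]`. -/
def coupling (d : ℕ) [NeZero d] (α : ℝ) : BlockOp d :=
  NormedSpace.exp ((-(Complex.I * α)) •
    (tensorOp (creat (basisVec 0)) (annih (basisVec 0)) +
      tensorOp (annih (basisVec 0)) (creat (basisVec 0))))

/-- The free one-step dynamics `U_F = Γ(S) ⊗ Γ(S_p)`. -/
def freeStep (d : ℕ) [NeZero d] : BlockOp d :=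
  tensorOp (secondQuant resShift).toContinuousLinearMap
    (secondQuant (sampleShift d)).toContinuousLinearMap

/-- The one-step dynamics `U = U_F K`. -/
def stepOp (d : ℕ) [NeZero d] (α : ℝ) : BlockOp d := freeStep d * coupling d α

theorem coupling_mem (d : ℕ) [NeZero d] (α : ℝ) : coupling d α ∈ obsAlgebra d :=
  NormedSpace.exp_mem (R := ℂ) (obsAlgebra_isClosed d) <| SMulMemClass.smul_mem _ <|
    add_mem (tensorOp_mem (creat_mem _) _) (tensorOp_mem (annih_mem _) _)

theorem freeStep_conj_mem (d : ℕ) [NeZero d] {M : BlockOp d} (hM : M ∈ obsAlgebra d) :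
    star (freeStep d) * M * freeStep d ∈ obsAlgebra d := by
  intro X Y
  rw [CStarMatrix.mul_apply]
  refine sum_mem fun Z _ => ?_
  rw [CStarMatrix.mul_apply, Finset.sum_mul]
  refine sum_mem fun Z' _ => ?_
  rw [CStarMatrix.star_apply, freeStep, tensorOp_apply, tensorOp_apply, star_smul, smul_mul_assoc,
    smul_mul_assoc, mul_smul_comm]
  exact SMulMemClass.smul_mem _ (SMulMemClass.smul_mem _ (conj_mem_carAlgebra _ (hM Z' Z)))

theorem stepOp_conj_mem (d : ℕ) [NeZero d] (α : ℝ) (t : ℕ) {M : BlockOp d}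
    (hM : M ∈ obsAlgebra d) :
    star (stepOp d α) ^ t * M * stepOp d α ^ t ∈ obsAlgebra d := by
  induction t generalizing M with
  | zero => simpa using hM
  | succ t ih =>
    have h : star (stepOp d α) * M * stepOp d α ∈ obsAlgebra d := by
      have h' := mul_mem (mul_mem (star_mem (coupling_mem d α)) (freeStep_conj_mem d hM))
        (coupling_mem d α)
      simpa only [stepOp, star_mul, mul_assoc] using h'
    have := ih h
    rw [pow_succ, pow_succ']
    simpa only [mul_assoc] using this

/-- The time evolution `τ^t(M) = (U*)^t M U^t` on `𝓑 ⊗ 𝓐`. -/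
def evolve (d : ℕ) [NeZero d] (α : ℝ) (t : ℕ) (M : obsAlgebra d) : obsAlgebra d :=
  ⟨star (stepOp d α) ^ t * (M : BlockOp d) * stepOp d α ^ t, stepOp_conj_mem d α t M.2⟩

/-- `c*(φ)` as an element of the CAR algebra. -/
def creatB {ι : Type} [LinearOrder ι] (φ : L2 ι) : carAlgebra ι := ⟨creat φ, creat_mem φ⟩

/-- `c(φ)` as an element of the CAR algebra. -/
def annihB {ι : Type} [LinearOrder ι] (φ : L2 ι) : carAlgebra ι := ⟨annih φ, annih_mem φ⟩

/-- `ω` is a state on the CAR algebra: a normalized positive linear functional. -/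
structure IsState {ι : Type} [LinearOrder ι] (ω : carAlgebra ι →ₗ[ℂ] ℂ) : Prop where
  map_one : ω 1 = 1
  re_nonneg : ∀ x, 0 ≤ (ω (star x * x)).re
  im_eq_zero : ∀ x, (ω (star x * x)).im = 0

/-- `ω` is the gauge-invariant quasi-free state with density `D`:
`ω(c*(φ_m) ⋯ c*(φ_1) c(ψ_1) ⋯ c(ψ_n)) = δ_{nm} det(⟨ψ_j, D φ_k⟩)`. -/
structure IsQuasiFree {ι : Type} [LinearOrder ι] (D : L2 ι →L[ℂ] L2 ι)
    (ω : carAlgebra ι →ₗ[ℂ] ℂ) : Prop extends IsState ω where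
  eq_det : ∀ (n : ℕ) (φ ψ : Fin n → L2 ι),
    ω ((List.ofFn fun i => creatB (φ i)).reverse.prod * (List.ofFn fun i => annihB (ψ i)).prod)
      = (Matrix.of fun j k => (inner ℂ (ψ j) (D (φ k)) : ℂ)).det
  eq_zero : ∀ (m n : ℕ) (φ : Fin m → L2 ι) (ψ : Fin n → L2 ι), m ≠ n →
    ω ((List.ofFn fun i => creatB (φ i)).reverse.prod * (List.ofFn fun i => annihB (ψ i)).prod) = 0

/-- The trace on the finite-dimensional space `F_-(ℂ^d)`. -/
def sampleTrace {d : ℕ} (A : Fock (Fin d) →L[ℂ] Fock (Fin d)) : ℂ :=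
  ∑ X : Finset (Fin d), inner ℂ (basisVec X) (A (basisVec X))

/-- `ρ` is a density matrix on `F_-(ℂ^d)`. -/
structure IsDensityMatrix {d : ℕ} (ρ : Fock (Fin d) →L[ℂ] Fock (Fin d)) : Prop where
  isPositive : ρ.IsPositive
  trace_eq_one : sampleTrace ρ = 1

/-- The product functional `ω ⊗ tr(ρ ·)` on `𝓑 ⊗ 𝓐`; on `b ⊗ A` it is `ω(b) tr(ρ A)`. -/
def productState {d : ℕ} (ω : carAlgebra ℤ →ₗ[ℂ] ℂ) (ρ : Fock (Fin d) →L[ℂ] Fock (Fin d))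
    (M : obsAlgebra d) : ℂ :=
  ∑ X : Finset (Fin d), ∑ Y : Finset (Fin d),
    ω ⟨(M : BlockOp d) X Y, M.2 X Y⟩ * inner ℂ (basisVec Y) (ρ (basisVec X))

/-- The sample observable `𝟙 ⊗ a_k* a_j`. -/
def hopObs {d : ℕ} (k j : Fin d) : obsAlgebra d :=
  ⟨tensorOp 1 (creat (basisVec k) * annih (basisVec j)), tensorOp_mem (one_mem _) _⟩

/-- The one-body reduced density matrix `⟨e_j, ρ⁽¹⁾ e_k⟩ = tr(ρ a_k* a_j)` of `ρ`. -/
def oneBody {d : ℕ} (ρ : Fock (Fin d) →L[ℂ] Fock (Fin d)) : Matrix (Fin d) (Fin d) ℂ :=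
  Matrix.of fun j k => sampleTrace (ρ * (creat (basisVec k) * annih (basisVec j)))

/-- The one-body reduced density matrix of the sample at time `t`, with entries
`⟨e_j, ρ⁽¹⁾_t e_k⟩ = (ω ⊗ ρ)(τ^t(𝟙 ⊗ a_k* a_j))`. -/
def oneBodyAt {d : ℕ} [NeZero d] (α : ℝ) (ω : carAlgebra ℤ →ₗ[ℂ] ℂ)
    (ρ : Fock (Fin d) →L[ℂ] Fock (Fin d)) (t : ℕ) : Matrix (Fin d) (Fin d) ℂ :=
  Matrix.of fun j k => productState ω ρ (evolve d α t (hopObs k j))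

/-- `σ(n) = ⟨Ψ_0, D Ψ_n⟩`; if `D` commutes with the shift, then `⟨Ψ_j, D Ψ_k⟩ = σ(k - j)`. -/
def symbol (D : L2 ℤ →L[ℂ] L2 ℤ) (n : ℤ) : ℂ := inner ℂ (basisVec 0) (D (basisVec n))

/-- The `d × d` block `σ^{(u)}`, with entries `σ^{(u)}_{jk} = σ(k - j + u d)`. -/
def block (d : ℕ) (D : L2 ℤ →L[ℂ] L2 ℤ) (u : ℤ) : Matrix (Fin d) (Fin d) ℂ :=
  Matrix.of fun j k => symbol D ((k.val : ℤ) - (j.val : ℤ) + u * d)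

/-- `B(m) = σ^{(0)} + ∑_{u=1}^m cos^u(α) (σ^{(u)} + σ^{(-u)})`. -/
def driveB (d : ℕ) (α : ℝ) (D : L2 ℤ →L[ℂ] L2 ℤ) (m : ℕ) : Matrix (Fin d) (Fin d) ℂ :=
  block d D 0 + ∑ u ∈ Finset.Icc 1 m, ((Real.cos α : ℂ) ^ u) • (block d D u + block d D (-u))

end RepeatedInteraction

end

open scoped ComplexConjugate

noncomputable section

namespace RepeatedInteraction

open ContinuousLinearMap

/-! In `𝓑 ⊗ 𝓐` the operators `b_n ⊗ 𝟙` and `𝟙 ⊗ a_j` commute instead of anticommuting, so `K* a_0 K`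
need not be linear in them. Two-sided multiplication `K c K` is linear. Write `H` for the generator
of the coupling. Then `{H, a_0} = b_0` and `{H, b_0} = a_0`, while `H` anticommutes with every other
`a_j` and `b_n`. Hence `K a_0 K = cos α a_0 - i sin α b_0`, and `K` fixes the other modes in this
sense.

The identity `K c K = x` says `c K = K* x`. Moving `c` through a product of steps therefore gives `c
U^t = V^t x`, with `V = U_F K*` the step with reversed coupling (`Carries`). As `V` is an isometry,
it cancels in quadratic expressions: `τ^t(c* c') = x* x'` (`Carries.evolve`). This is enough for
`a_k* a_j`.

The free step raises indices by one. In `d` steps `a_j` passes the contact mode `0` once and becomes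
`cos α a_j - i sin α b_j`; a reservoir mode with index at least `0` drifts away and never returns
(`carries_samAnnih_period`, `carries_resAnnih`). After `m` periods `a_j` is a combination of `a_j`
and the `b_{j+id}` with `i < m`.

In the product state the mixed terms vanish and the reservoir terms are values of `σ`. Separating
off the newest reservoir mode yields the recursion with drive `B(m)` (`oneBodyAt_succ`). Its
solution is algebra (`solve_recursion`), and the limit follows entrywise from `|cos α| < 1` and the
boundedness of `σ`. -/

/-! ### Exponentials and anticommutators -/

theorem exp_neg_mul_exp_complex {A : Type*} [NormedRing A] [NormedAlgebra ℂ A] [CompleteSpace A]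
    (x : A) : NormedSpace.exp (-x) * NormedSpace.exp x = 1 := by
  let _ : NormedAlgebra ℚ A := NormedAlgebra.restrictScalars ℚ ℂ A
  rw [← NormedSpace.exp_add_of_commute (Commute.refl _).neg_left, neg_add_cancel,
    NormedSpace.exp_zero]

/-- If `H c + c H = l c`, then conjugating `c` by the exponential on both sides rescales it. -/
theorem exp_mul_mul_exp_of_anticomm {A : Type*} [NormedRing A] [NormedAlgebra ℂ A]
    [CompleteSpace A] {H c : A} {l : ℂ} (h : H * c + c * H = l • c) (z : ℂ) :
    NormedSpace.exp (z • H) * c * NormedSpace.exp (z • H) = Complex.exp (z * l) • c := by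
  let _ : NormedAlgebra ℚ A := NormedAlgebra.restrictScalars ℚ ℂ A
  -- The hypothesis reads `H c = c (l - H)`. Exponentiating gives `exp(zH) c = e^{zl} c exp(-zH)`,
  -- and the last factor cancels against `exp(zH)` on the right.
  have h1 : SemiconjBy c ((z * l) • 1 + -(z • H)) (z • H) := by
    change c * _ = _ * c
    have : H * c = l • c - c * H := eq_sub_of_add_eq h
    rw [smul_mul_assoc, this, mul_add, mul_neg, mul_smul_comm, mul_smul_comm, mul_one, smul_sub,
      mul_smul, sub_eq_add_neg]
  have h2 : NormedSpace.exp ((z * l) • (1 : A)) = Complex.exp (z * l) • 1 := by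
    rw [← Algebra.algebraMap_eq_smul_one, ← NormedSpace.algebraMap_exp_comm,
      Algebra.algebraMap_eq_smul_one, Complex.exp_eq_exp_ℂ]
  have h3 := h1.exp_right
  rw [NormedSpace.exp_add_of_commute ((Commute.one_left _).smul_left _), h2] at h3
  have h4 := exp_neg_mul_exp_complex (z • H)
  rw [← h3.eq, mul_assoc, smul_mul_assoc, one_mul, smul_mul_assoc, h4, mul_smul_comm, mul_one]

/-- `(x, y)` with `{H, x} = y` and `{H, y} = x` is rotated hyperbolically. -/
theorem exp_mul_mul_exp_of_swap {A : Type*} [NormedRing A] [NormedAlgebra ℂ A]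
    [CompleteSpace A] {H x y : A} (hx : H * x + x * H = y) (hy : H * y + y * H = x) (z : ℂ) :
    NormedSpace.exp (z • H) * x * NormedSpace.exp (z • H)
      = Complex.cosh z • x + Complex.sinh z • y := by
  -- `x + y` and `x - y` are eigenvectors of `c ↦ H c + c H` with eigenvalues `1` and `-1`; `x` is
  -- half their sum.
  have hp : H * (x + y) + (x + y) * H = (1 : ℂ) • (x + y) := by
    rw [one_smul]; nth_rewrite 3 [← hy]; nth_rewrite 5 [← hx]; noncomm_ring
  have hm : H * (x - y) + (x - y) * H = (-1 : ℂ) • (x - y) := by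
    rw [neg_one_smul]; nth_rewrite 3 [← hy]; nth_rewrite 5 [← hx]; noncomm_ring
  have ep := exp_mul_mul_exp_of_anticomm hp z
  have em := exp_mul_mul_exp_of_anticomm hm z
  have hxs : x = (1 / 2 : ℂ) • (x + y) + (1 / 2 : ℂ) • (x - y) := by module
  have : NormedSpace.exp (z • H) * x * NormedSpace.exp (z • H)
      = (1 / 2 : ℂ) • (Complex.exp (z * 1) • (x + y))
        + (1 / 2 : ℂ) • (Complex.exp (z * -1) • (x - y)) := by
    rw [← ep, ← em]
    nth_rewrite 1 [hxs]
    simp only [mul_add, add_mul, mul_smul_comm, smul_mul_assoc]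
  rw [this, Complex.cosh, Complex.sinh, mul_one, mul_neg_one]
  module

/-! ### Algebra of elementary tensors -/

section tensor
variable {d : ℕ}

/-- Inserts the resolution of the identity over the basis `e_Z`, a finite sum on the sample's Fock
space. This turns block matrix multiplication into composition in the second factor. -/
theorem inner_mul_basisVec (A B : Fock (Fin d) →L[ℂ] Fock (Fin d)) (X Y : Finset (Fin d)) :
    (inner ℂ (basisVec X) ((A * B) (basisVec Y)) : ℂ)
      = ∑ Z, inner ℂ (basisVec X) (A (basisVec Z)) * inner ℂ (basisVec Z) (B (basisVec Y)) := by
  have h : B (basisVec Y) = ∑ Z, (B (basisVec Y)) Z • basisVec Z := by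
    ext W
    rw [lp.coeFn_sum, Finset.sum_apply]
    simp [basisVec_apply]
  change inner ℂ (basisVec X) (A (B (basisVec Y))) = _
  nth_rewrite 1 [h]
  rw [map_sum, inner_sum]
  refine Finset.sum_congr rfl fun Z _ => ?_
  rw [map_smul, inner_smul_right, inner_basisVec_left Z, mul_comm]

theorem tensorOp_mul (T T' : Fock ℤ →L[ℂ] Fock ℤ) (A A' : Fock (Fin d) →L[ℂ] Fock (Fin d)) :
    tensorOp T A * tensorOp T' A' = tensorOp (T * T') (A * A') := by
  ext X Y : 1
  rw [CStarMatrix.mul_apply, tensorOp_apply, inner_mul_basisVec, Finset.sum_smul]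
  refine Finset.sum_congr rfl fun Z _ => ?_
  rw [tensorOp_apply, tensorOp_apply, smul_mul_smul_comm]

theorem tensorOp_star (T : Fock ℤ →L[ℂ] Fock ℤ) (A : Fock (Fin d) →L[ℂ] Fock (Fin d)) :
    star (tensorOp T A) = tensorOp (star T) (star A) := by
  ext X Y : 1
  rw [CStarMatrix.star_apply, tensorOp_apply, tensorOp_apply, star_smul, star_eq_adjoint A,
    adjoint_inner_right, ← inner_conj_symm, starRingEnd_apply,
    star_star]

theorem tensorOp_one : tensorOp (1 : Fock ℤ →L[ℂ] Fock ℤ) 1 = (1 : BlockOp d) := by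
  ext X Y : 1
  rw [tensorOp_apply, CStarMatrix.one_apply, one_apply_eq_self, inner_basisVec_left, basisVec_apply]
  split_ifs <;> simp

theorem tensorOp_add_left (T T' : Fock ℤ →L[ℂ] Fock ℤ) (A : Fock (Fin d) →L[ℂ] Fock (Fin d)) :
    tensorOp (T + T') A = tensorOp T A + tensorOp T' A := by
  ext X Y : 1
  rw [CStarMatrix.add_apply, tensorOp_apply, tensorOp_apply, tensorOp_apply, smul_add]

theorem tensorOp_add_right (T : Fock ℤ →L[ℂ] Fock ℤ) (A A' : Fock (Fin d) →L[ℂ] Fock (Fin d)) :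
    tensorOp T (A + A') = tensorOp T A + tensorOp T A' := by
  ext X Y : 1
  rw [CStarMatrix.add_apply, tensorOp_apply, tensorOp_apply, tensorOp_apply, add_apply,
    inner_add_right, add_smul]

theorem tensorOp_smul_left (c : ℂ) (T : Fock ℤ →L[ℂ] Fock ℤ)
    (A : Fock (Fin d) →L[ℂ] Fock (Fin d)) : tensorOp (c • T) A = c • tensorOp T A := by
  ext X Y : 1
  rw [CStarMatrix.smul_apply, tensorOp_apply, tensorOp_apply, smul_comm]

theorem tensorOp_smul_right (c : ℂ) (T : Fock ℤ →L[ℂ] Fock ℤ)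
    (A : Fock (Fin d) →L[ℂ] Fock (Fin d)) : tensorOp T (c • A) = c • tensorOp T A := by
  ext X Y : 1
  rw [CStarMatrix.smul_apply, tensorOp_apply, tensorOp_apply, smul_apply, inner_smul_right,
    mul_smul]

end tensor

/-! ### One step: coupling and free evolution of single modes -/

theorem annih_anticomm {ι : Type} [LinearOrder ι] (φ χ : L2 ι) :
    annih φ * annih χ + annih χ * annih φ = 0 := by
  have := congrArg star (creat_anticomm χ φ)
  rw [star_add, star_mul, star_mul, star_zero] at this
  exact this

/-- The annihilation operator `b_n ⊗ 𝟙`. -/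
def resAnnih (d : ℕ) (n : ℤ) : BlockOp d := tensorOp (annih (basisVec n)) 1

/-- The annihilation operator `𝟙 ⊗ a_j`. -/
def samAnnih {d : ℕ} (j : Fin d) : BlockOp d := tensorOp 1 (annih (basisVec j))

/-- The generator `b₀* ⊗ a₀ + b₀ ⊗ a₀*` of the coupling. -/
def couplingGen (d : ℕ) [NeZero d] : BlockOp d :=
  tensorOp (creat (basisVec 0)) (annih (basisVec 0)) +
    tensorOp (annih (basisVec 0)) (creat (basisVec 0))

section dynamics
variable {d : ℕ} [NeZero d]

theorem star_couplingGen : star (couplingGen d) = couplingGen d := by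
  have h1 : ∀ {ι : Type} [LinearOrder ι] (φ : L2 ι), star (creat φ) = annih φ := fun φ => rfl
  have h2 : ∀ {ι : Type} [LinearOrder ι] (φ : L2 ι), star (annih φ) = creat φ := fun φ =>
    star_star (creat φ)
  rw [couplingGen, star_add, tensorOp_star, tensorOp_star, h1, h1, h2, h2, add_comm]

/-- The sample factor of `b_n ⊗ 𝟙` is trivial, so the anticommutator acts in the reservoir factor
alone: it is `{b_0*, b_n} ⊗ a_0 + {b_0, b_n} ⊗ a_0*`, and the CAR evaluate both brackets. -/
theorem couplingGen_resAnnih (n : ℤ) :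
    couplingGen d * resAnnih d n + resAnnih d n * couplingGen d
      = if n = 0 then samAnnih 0 else 0 := by
  have h1 := annih_creat_car (basisVec n) (basisVec (0 : ℤ))
  have h2 := annih_anticomm (basisVec n) (basisVec (0 : ℤ))
  rw [couplingGen, resAnnih, add_mul, mul_add, tensorOp_mul, tensorOp_mul, tensorOp_mul,
    tensorOp_mul, mul_one, one_mul, mul_one, one_mul, add_add_add_comm, ← tensorOp_add_left,
    ← tensorOp_add_left, add_comm (creat _ * _), h1, add_comm (annih (basisVec 0) * _), h2,
    inner_basisVec_left, basisVec_apply, tensorOp_smul_left, samAnnih]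
  have : tensorOp (0 : Fock ℤ →L[ℂ] Fock ℤ) (creat (basisVec 0)) = (0 : BlockOp d) := by
    ext X Y : 1
    simp [tensorOp_apply]
  rw [this]
  split_ifs <;> simp

theorem couplingGen_samAnnih (j : Fin d) :
    couplingGen d * samAnnih j + samAnnih j * couplingGen d
      = if j = 0 then resAnnih d 0 else 0 := by
  have h1 := annih_creat_car (basisVec j) (basisVec (0 : Fin d))
  have h2 := annih_anticomm (basisVec j) (basisVec (0 : Fin d))
  rw [couplingGen, samAnnih, add_mul, mul_add, tensorOp_mul, tensorOp_mul, tensorOp_mul,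
    tensorOp_mul, mul_one, one_mul, mul_one, one_mul, add_add_add_comm, ← tensorOp_add_right,
    ← tensorOp_add_right, add_comm (creat _ * _), h1, add_comm (annih (basisVec 0) * _), h2,
    inner_basisVec_left, basisVec_apply, tensorOp_smul_right, resAnnih]
  have : tensorOp (creat (basisVec 0)) (0 : Fock (Fin d) →L[ℂ] Fock (Fin d))
      = (0 : BlockOp d) := by
    ext X Y : 1
    simp [tensorOp_apply]
  rw [this]
  split_ifs <;> simp

theorem coupling_eq (α : ℝ) :
    coupling d α = NormedSpace.exp ((-(Complex.I * α)) • couplingGen d) := rfl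

theorem cosh_neg_I_mul (α : ℝ) : Complex.cosh (-(Complex.I * α)) = (Real.cos α : ℂ) := by
  rw [Complex.cosh_neg, mul_comm, Complex.cosh_mul_I, Complex.ofReal_cos]

theorem sinh_neg_I_mul (α : ℝ) :
    Complex.sinh (-(Complex.I * α)) = -(Complex.I * (Real.sin α : ℂ)) := by
  rw [Complex.sinh_neg, mul_comm, Complex.sinh_mul_I, Complex.ofReal_sin, mul_comm]

/-- `a_0` and `b_0` are exchanged by the anticommutator with the generator; the hyperbolic rotation
at `z = -iα` becomes a trigonometric one. Both outer factors are `K`, neither is `K*`. -/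
theorem coupling_samAnnih_zero (α : ℝ) :
    coupling d α * samAnnih 0 * coupling d α
      = (Real.cos α : ℂ) • samAnnih 0 + (-(Complex.I * (Real.sin α : ℂ))) • resAnnih d 0 := by
  rw [← cosh_neg_I_mul, ← sinh_neg_I_mul, coupling_eq]
  exact exp_mul_mul_exp_of_swap (by rw [couplingGen_samAnnih, if_pos rfl])
    (by rw [couplingGen_resAnnih, if_pos rfl]) _

theorem coupling_samAnnih {j : Fin d} (hj : j ≠ 0) (α : ℝ) :
    coupling d α * samAnnih j * coupling d α = samAnnih j := by
  have := exp_mul_mul_exp_of_anticomm (H := couplingGen d) (c := samAnnih j) (l := 0)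
    (by rw [couplingGen_samAnnih, if_neg hj, zero_smul]) (-(Complex.I * α))
  rwa [mul_zero, Complex.exp_zero, one_smul] at this

theorem coupling_resAnnih {n : ℤ} (hn : n ≠ 0) (α : ℝ) :
    coupling d α * resAnnih d n * coupling d α = resAnnih d n := by
  have := exp_mul_mul_exp_of_anticomm (H := couplingGen d) (c := resAnnih d n) (l := 0)
    (by rw [couplingGen_resAnnih, if_neg hn, zero_smul]) (-(Complex.I * α))
  rwa [mul_zero, Complex.exp_zero, one_smul] at this

theorem star_coupling (α : ℝ) :
    star (coupling d α) = NormedSpace.exp (-((-(Complex.I * α)) • couplingGen d)) := by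
  rw [coupling_eq, NormedSpace.star_exp, star_smul, star_couplingGen, ← neg_smul]
  congr 2
  simp

theorem star_coupling_mul (α : ℝ) : star (coupling d α) * coupling d α = 1 := by
  rw [star_coupling]
  exact exp_neg_mul_exp_complex _

theorem coupling_mul_star (α : ℝ) : coupling d α * star (coupling d α) = 1 := by
  have := exp_neg_mul_exp_complex (-((-(Complex.I * α)) • couplingGen d))
  rwa [neg_neg, ← star_coupling] at this

theorem star_freeStep_mul : star (freeStep d) * freeStep d = 1 := by
  rw [freeStep, tensorOp_star, tensorOp_mul, star_eq_adjoint, star_eq_adjoint,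
    adjoint_mul_self_of_isometry, adjoint_mul_self_of_isometry, tensorOp_one]

/-- `b(SΨ) Γ(S) = Γ(S) b(Ψ)` at `Ψ = Ψ_{n+1}`. Since `S` lowers the index, moving the operator to
the right raises it. -/
theorem resAnnih_mul_freeStep (n : ℤ) :
    resAnnih d n * freeStep d = freeStep d * resAnnih d (n + 1) := by
  have h := secondQuant_comp_annihBasis resShift (n + 1)
  rw [resShift, permIso_basisVec, ← creat_basisVec] at h
  have hn : Equiv.subRight 1 (n + 1) = n := by simp
  rw [hn] at h
  rw [resAnnih, resAnnih, freeStep, tensorOp_mul, tensorOp_mul, one_mul, mul_one, resShift, h]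
  rfl

theorem samAnnih_mul_freeStep (j : Fin d) :
    samAnnih j * freeStep d = freeStep d * samAnnih (j + 1) := by
  have h := secondQuant_comp_annihBasis (sampleShift d) (j + 1)
  rw [sampleShift, permIso_basisVec, ← creat_basisVec] at h
  have hn : Equiv.subRight 1 (j + 1) = j := by simp
  rw [hn] at h
  rw [samAnnih, samAnnih, freeStep, tensorOp_mul, tensorOp_mul, one_mul, mul_one, sampleShift, h]
  rfl

/-! ### Transport of annihilation operators over many steps -/

/-- The step `U_F K*` with the coupling reversed. -/
def revStep (d : ℕ) [NeZero d] (α : ℝ) : BlockOp d := freeStep d * star (coupling d α)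

theorem star_revStep_mul (α : ℝ) : star (revStep d α) * revStep d α = 1 := by
  rw [revStep, star_mul, star_star, mul_assoc, ← mul_assoc (star (freeStep d)),
    star_freeStep_mul, one_mul, coupling_mul_star]

/-- `c` is carried to `x` by `t` steps: `c U^t = V^t x`, where `V = U_F K*`. -/
def Carries (d : ℕ) [NeZero d] (α : ℝ) (t : ℕ) (c x : BlockOp d) : Prop :=
  c * stepOp d α ^ t = revStep d α ^ t * x

variable {α : ℝ}

theorem Carries.zero (c : BlockOp d) : Carries d α 0 c c := by
  rw [Carries, pow_zero, pow_zero, one_mul, mul_one]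

theorem Carries.trans {s t : ℕ} {c x y : BlockOp d} (h : Carries d α s c x)
    (h' : Carries d α t x y) : Carries d α (s + t) c y := by
  rw [Carries] at *
  rw [pow_add, ← mul_assoc, h, mul_assoc, h', pow_add, mul_assoc]

theorem Carries.add {t : ℕ} {c x c' x' : BlockOp d} (h : Carries d α t c x)
    (h' : Carries d α t c' x') : Carries d α t (c + c') (x + x') := by
  rw [Carries] at *
  rw [add_mul, mul_add, h, h']

theorem Carries.smul {t : ℕ} {c x : BlockOp d} (h : Carries d α t c x) (r : ℂ) :
    Carries d α t (r • c) (r • x) := by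
  rw [Carries] at *
  rw [smul_mul_assoc, mul_smul_comm, h]

/-- The left side is `(c U^t)* (c' U^t) = x* (V^t)* V^t x'`, and the isometry `V^t` drops out. This
is what `Carries` is for: single operators are transported linearly, although only pairs evolve
without a leftover factor. -/
theorem Carries.evolve {t : ℕ} {c x c' x' : BlockOp d} (h : Carries d α t c x)
    (h' : Carries d α t c' x') :
    star (stepOp d α) ^ t * (star c * c') * stepOp d α ^ t = star x * x' := by
  have hV : star (revStep d α ^ t) * revStep d α ^ t = 1 := by
    clear h h'
    rw [star_pow]
    induction t with
    | zero => simp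
    | succ t ih =>
      rw [pow_succ, pow_succ', mul_assoc, ← mul_assoc (star (revStep d α)), star_revStep_mul,
        one_mul, ih]
  rw [← star_pow]
  calc _ = star (c * stepOp d α ^ t) * (c' * stepOp d α ^ t) := by
        rw [star_mul]; noncomm_ring
    _ = star x * (star (revStep d α ^ t) * revStep d α ^ t) * x' := by
        rw [h, h', star_mul]; noncomm_ring
    _ = _ := by rw [hV, mul_one]

/-- `c U_F K = U_F c' K = U_F K* (K c' K)`. -/
theorem Carries.of_freeStep {c c' x : BlockOp d} (h : c * freeStep d = freeStep d * c')
    (h' : coupling d α * c' * coupling d α = x) : Carries d α 1 c x := by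
  rw [Carries, pow_one, pow_one, stepOp, revStep, ← mul_assoc, h, ← h']
  simp only [mul_assoc]
  rw [← mul_assoc (star (coupling d α)), star_coupling_mul, one_mul]

/-- The shift acts before the coupling, so a mode starting at index `n ≥ 0` meets the coupling only
at indices at least `1`. Index `0` is thus allowed as a start: a mode that has just interacted does
not interact again. -/
theorem carries_resAnnih (n t : ℕ) :
    Carries d α t (resAnnih d n) (resAnnih d ((n + t : ℕ) : ℤ)) := by
  induction t with
  | zero => exact Carries.zero _
  | succ t ih =>
    refine ih.trans (Carries.of_freeStep (resAnnih_mul_freeStep _) ?_)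
    rw [coupling_resAnnih (by positivity)]
    push_cast
    rw [add_assoc]

/-- The coupling is met only at the indices `n + 1, …, n + t`, all strictly between `0` and `d`,
hence never at the contact site. -/
theorem carries_samAnnih_of_lt {n t : ℕ} (h : n + t < d) :
    Carries d α t (samAnnih (Fin.ofNat d n)) (samAnnih (Fin.ofNat d (n + t))) := by
  induction t with
  | zero => exact Carries.zero _
  | succ t ih =>
    have e : Fin.ofNat d (n + t) + 1 = Fin.ofNat d (n + (t + 1)) := by
      ext; simp [Fin.val_add, Fin.ofNat]; rfl
    refine (ih (by omega)).trans (Carries.of_freeStep (samAnnih_mul_freeStep _) ?_)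
    rw [e, coupling_samAnnih]
    intro h0
    have := congrArg Fin.val h0
    simp only [Fin.val_ofNat, Fin.val_zero] at this
    rw [Nat.mod_eq_of_lt h] at this
    omega

/-- In `d` steps, `a_j` passes the reservoir exactly once. -/
theorem carries_samAnnih_period (j : Fin d) :
    Carries d α d (samAnnih j) ((Real.cos α : ℂ) • samAnnih j +
      (-(Complex.I * (Real.sin α : ℂ))) • resAnnih d j.val) := by
  have hd := NeZero.pos d
  have hj := j.2
  -- The period splits as `d = (d - 1 - j) + 1 + j`: up to site `d - 1`, one interacting step onto
  -- site `0`, then on to site `j`, while the emitted `b_0` moves to `b_j`.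
  have h1 : Carries d α (d - 1 - j) (samAnnih j) (samAnnih (Fin.ofNat d (d - 1))) := by
    have := carries_samAnnih_of_lt (d := d) (α := α) (n := j) (t := d - 1 - j) (by omega)
    rwa [Fin.ofNat_val_eq_self, show (j : ℕ) + (d - 1 - j) = d - 1 by omega] at this
  have h2 : Carries d α 1 (samAnnih (Fin.ofNat d (d - 1))) _ :=
    Carries.of_freeStep (samAnnih_mul_freeStep _) (by
      have : Fin.ofNat d (d - 1) + 1 = 0 := by
        ext; simp [Fin.val_add, Nat.sub_add_cancel hd]
      rw [this, coupling_samAnnih_zero])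
  have h3 : Carries d α j (samAnnih 0) (samAnnih j) := by
    have := carries_samAnnih_of_lt (d := d) (α := α) (n := 0) (t := j) (by omega)
    rwa [zero_add, Fin.ofNat_val_eq_self] at this
  have h4 : Carries d α j (resAnnih d 0) (resAnnih d j.val) := by
    have := carries_resAnnih (d := d) (α := α) 0 j
    rwa [zero_add] at this
  have := (h1.trans h2).trans ((h3.smul _).add (h4.smul _))
  rwa [show d - 1 - (j : ℕ) + 1 + j = d by omega] at this

/-- The image of `a_j` under `m` periods. -/
def evolvedAnnih (α : ℝ) (j : Fin d) : ℕ → BlockOp d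
  | 0 => samAnnih j
  | m + 1 => (Real.cos α : ℂ) • evolvedAnnih α j m +
      (-(Complex.I * (Real.sin α : ℂ))) • resAnnih d ((j.val + m * d : ℕ) : ℤ)

theorem carries_evolvedAnnih (j : Fin d) (m : ℕ) :
    Carries d α (m * d) (samAnnih j) (evolvedAnnih α j m) := by
  induction m with
  | zero => rw [zero_mul]; exact Carries.zero _
  | succ m ih =>
    -- The first period is split off, not the last: its `b_j` then drifts for `m * d` steps to
    -- `b_{j+md}`, while the induction hypothesis handles its `a_j`.
    rw [Nat.succ_mul, add_comm]
    exact (carries_samAnnih_period j).trans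
      ((ih.smul _).add ((carries_resAnnih j.val (m * d)).smul _))

end dynamics

/-! ### Two-point functions in the product state -/

section expectation
variable {d : ℕ} (ω : carAlgebra ℤ →ₗ[ℂ] ℂ) (ρ : Fock (Fin d) →L[ℂ] Fock (Fin d))

theorem productState_add (M N : obsAlgebra d) :
    productState ω ρ (M + N) = productState ω ρ M + productState ω ρ N := by
  simp only [productState, ← Finset.sum_add_distrib, ← add_mul, ← map_add]
  rfl

theorem productState_smul (r : ℂ) (M : obsAlgebra d) :
    productState ω ρ (r • M) = r * productState ω ρ M := by
  have h : ∀ X Y, ω ⟨(r • M : obsAlgebra d).1 X Y, (r • M).2 X Y⟩ = r * ω ⟨M.1 X Y, M.2 X Y⟩ :=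
    fun X Y => by
      rw [← smul_eq_mul, ← map_smul]
      rfl
  simp only [productState, h, Finset.mul_sum, mul_assoc]

theorem productState_tensorOp {T : Fock ℤ →L[ℂ] Fock ℤ} (hT : T ∈ carAlgebra ℤ)
    (A : Fock (Fin d) →L[ℂ] Fock (Fin d)) :
    productState ω ρ ⟨tensorOp T A, tensorOp_mem hT A⟩ = ω ⟨T, hT⟩ * sampleTrace (ρ * A) := by
  have h : ∀ X Y, ω ⟨tensorOp T A X Y, tensorOp_mem hT A X Y⟩
      = inner ℂ (basisVec X) (A (basisVec Y)) * ω ⟨T, hT⟩ := fun X Y => by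
    rw [← smul_eq_mul, ← map_smul]
    rfl
  simp only [productState, h, sampleTrace, inner_mul_basisVec, Finset.mul_sum]
  rw [Finset.sum_comm]
  exact Finset.sum_congr rfl fun _ _ => Finset.sum_congr rfl fun _ _ => by ring

/-- `b_n ⊗ 𝟙` as an observable. -/
def resObs (d : ℕ) (n : ℤ) : obsAlgebra d := ⟨resAnnih d n, tensorOp_mem (annih_mem _) _⟩

/-- `𝟙 ⊗ a_j` as an observable. -/
def samObs (j : Fin d) : obsAlgebra d := ⟨samAnnih j, tensorOp_mem (one_mem _) _⟩

theorem star_annih {ι : Type} [LinearOrder ι] (φ : L2 ι) : star (annih φ) = creat φ :=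
  star_star (creat φ)

theorem productState_of_eq {M : obsAlgebra d} {T : Fock ℤ →L[ℂ] Fock ℤ} (hT : T ∈ carAlgebra ℤ)
    {A : Fock (Fin d) →L[ℂ] Fock (Fin d)} (h : (M : BlockOp d) = tensorOp T A) :
    productState ω ρ M = ω ⟨T, hT⟩ * sampleTrace (ρ * A) := by
  rw [← productState_tensorOp]
  exact congrArg _ (Subtype.ext h)

variable {ω ρ} {D : L2 ℤ →L[ℂ] L2 ℤ}

theorem IsQuasiFree.map_creatB (hω : IsQuasiFree D ω) (φ : L2 ℤ) : ω (creatB φ) = 0 := by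
  simpa using hω.eq_zero 1 0 (fun _ => φ) Fin.elim0 (by norm_num)

theorem IsQuasiFree.map_annihB (hω : IsQuasiFree D ω) (φ : L2 ℤ) : ω (annihB φ) = 0 := by
  simpa using hω.eq_zero 0 1 Fin.elim0 (fun _ => φ) (by norm_num)

theorem IsQuasiFree.map_creatB_mul_annihB (hω : IsQuasiFree D ω) (φ ψ : L2 ℤ) :
    ω (creatB φ * annihB ψ) = inner ℂ ψ (D φ) := by
  simpa using hω.eq_det 1 (fun _ => φ) (fun _ => ψ)

theorem productState_sam_sam (hω : IsQuasiFree D ω) (k j : Fin d) :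
    productState ω ρ (star (samObs k) * samObs j) = oneBody ρ j k := by
  have h : ((star (samObs k) * samObs j : obsAlgebra d) : BlockOp d)
      = tensorOp 1 (creat (basisVec k) * annih (basisVec j)) := by
    change star (samAnnih k) * samAnnih j = _
    rw [samAnnih, samAnnih, tensorOp_star, tensorOp_mul, star_one, one_mul, star_annih]
  rw [productState_of_eq ω ρ (one_mem _) h]
  have : ω ⟨1, one_mem _⟩ = 1 := hω.map_one
  rw [this, one_mul]
  rfl

theorem productState_res_res (hω : IsQuasiFree D ω) (hρ : IsDensityMatrix ρ) (p q : ℤ) :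
    productState ω ρ (star (resObs d p) * resObs d q)
      = inner ℂ (basisVec q) (D (basisVec p)) := by
  have h : ((star (resObs d p) * resObs d q : obsAlgebra d) : BlockOp d)
      = tensorOp (creat (basisVec p) * annih (basisVec q)) 1 := by
    change star (resAnnih d p) * resAnnih d q = _
    rw [resAnnih, resAnnih, tensorOp_star, tensorOp_mul, star_one, one_mul, star_annih]
  rw [productState_of_eq ω ρ (mul_mem (creat_mem _) (annih_mem _)) h, mul_one, hρ.trace_eq_one,
    mul_one]
  exact hω.map_creatB_mul_annihB _ _

/-- The reservoir factor is a single annihilation operator, on which the gauge-invariant `ω`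
vanishes, so no assumption on the sample expectation is needed. -/
theorem productState_sam_res (hω : IsQuasiFree D ω) (k : Fin d) (q : ℤ) :
    productState ω ρ (star (samObs k) * resObs d q) = 0 := by
  have h : ((star (samObs k) * resObs d q : obsAlgebra d) : BlockOp d)
      = tensorOp (annih (basisVec q)) (creat (basisVec k)) := by
    change star (samAnnih k) * resAnnih d q = _
    rw [samAnnih, resAnnih, tensorOp_star, tensorOp_mul, star_one, one_mul, mul_one, star_annih]
  rw [productState_of_eq ω ρ (annih_mem _) h]
  exact mul_eq_zero_of_left (hω.map_annihB _) _

theorem productState_res_sam (hω : IsQuasiFree D ω) (p : ℤ) (j : Fin d) :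
    productState ω ρ (star (resObs d p) * samObs j) = 0 := by
  have h : ((star (resObs d p) * samObs j : obsAlgebra d) : BlockOp d)
      = tensorOp (creat (basisVec p)) (annih (basisVec j)) := by
    change star (resAnnih d p) * samAnnih j = _
    rw [samAnnih, resAnnih, tensorOp_star, tensorOp_mul, star_one, one_mul, mul_one, star_annih]
  rw [productState_of_eq ω ρ (creat_mem _) h]
  exact mul_eq_zero_of_left (hω.map_creatB _) _

end expectation

/-! ### Translation invariance and boundedness of the symbol -/

/-- As `S` is isometric and commutes with `D`, moving both indices by one changes nothing; induction
on `q` in both directions brings the left index to `0`. -/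
theorem inner_basisVec_eq_symbol {D : L2 ℤ →L[ℂ] L2 ℤ}
    (hDS : D * resShift.toContinuousLinearMap = resShift.toContinuousLinearMap * D) (q p : ℤ) :
    inner ℂ (basisVec q) (D (basisVec p)) = symbol D (p - q) := by
  have hS : ∀ n : ℤ, resShift (basisVec (n + 1)) = basisVec n := fun n => by
    rw [resShift, permIso_basisVec]; simp
  have step : ∀ q p : ℤ, (inner ℂ (basisVec q) (D (basisVec p)) : ℂ)
      = inner ℂ (basisVec (q + 1)) (D (basisVec (p + 1))) := fun q p => by
    have h : D (resShift (basisVec (p + 1))) = resShift (D (basisVec (p + 1))) :=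
      congrArg (fun T : L2 ℤ →L[ℂ] L2 ℤ => T (basisVec (p + 1))) hDS
    rw [← resShift.inner_map_map (basisVec (q + 1)), ← h, hS, hS]
  induction q using Int.induction_on generalizing p with
  | zero => rw [sub_zero]; rfl
  | succ n ih =>
    have := step n (p - 1)
    rw [sub_add_cancel] at this
    rw [← this, ih]
    congr 1
    ring
  | pred n ih =>
    rw [step, sub_add_cancel, ih]
    congr 1
    ring

theorem norm_symbol_le (D : L2 ℤ →L[ℂ] L2 ℤ) (n : ℤ) : ‖symbol D n‖ ≤ ‖D‖ := by
  have h : ∀ m : ℤ, ‖(basisVec m : L2 ℤ)‖ = 1 := fun m => basisVec_orthonormal.1 m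
  calc ‖symbol D n‖ ≤ ‖(basisVec 0 : L2 ℤ)‖ * ‖D (basisVec n)‖ := norm_inner_le_norm _ _
    _ ≤ ‖(basisVec 0 : L2 ℤ)‖ * (‖D‖ * ‖(basisVec n : L2 ℤ)‖) := by
        gcongr; exact D.le_opNorm _
    _ = ‖D‖ := by rw [h, h, one_mul, mul_one]

theorem sum_Icc_one_eq_sum_range {M : Type*} [AddCommMonoid M] (f : ℕ → M) (m : ℕ) :
    ∑ u ∈ Finset.Icc 1 m, f u = ∑ i ∈ Finset.range m, f (i + 1) := by
  induction m with
  | zero => simp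
  | succ m ih => rw [Finset.sum_Icc_succ_top (by omega), ih, Finset.sum_range_succ]

/-! ### The recursion for the one-body density matrix -/

section recursion
variable {d : ℕ}

/-- The image of `a_j` under `m` periods, as an observable. -/
def evolvedObs (α : ℝ) (j : Fin d) : ℕ → obsAlgebra d
  | 0 => samObs j
  | m + 1 => (Real.cos α : ℂ) • evolvedObs α j m +
      (-(Complex.I * (Real.sin α : ℂ))) • resObs d ((j.val + m * d : ℕ) : ℤ)

theorem coe_evolvedObs (α : ℝ) (j : Fin d) (m : ℕ) :
    (evolvedObs α j m : BlockOp d) = evolvedAnnih α j m := by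
  induction m with
  | zero => rfl
  | succ m ih => rw [evolvedAnnih, ← ih]; rfl

variable {ω : carAlgebra ℤ →ₗ[ℂ] ℂ} {ρ : Fock (Fin d) →L[ℂ] Fock (Fin d)} {D : L2 ℤ →L[ℂ] L2 ℤ}

theorem star_evolvedObs_succ (α : ℝ) (j : Fin d) (m : ℕ) :
    star (evolvedObs α j (m + 1)) = (Real.cos α : ℂ) • star (evolvedObs α j m) +
      (Complex.I * (Real.sin α : ℂ)) • star (resObs d ((j.val + m * d : ℕ) : ℤ)) := by
  rw [evolvedObs, star_add, star_smul, star_smul]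
  simp only [Complex.star_def, map_neg, map_mul, Complex.conj_I, Complex.conj_ofReal, neg_mul,
    neg_neg]

/-- Cross term of the recursion, which needs `r = 0` only. The offset `r` keeps the induction going:
peeling the newest mode off `evolvedObs α k (m + 1)` leaves the same reservoir mode one period
further ahead, so `r` becomes `r + 1`, and the peeled mode supplies the `i = 0` summand. -/
theorem productState_evolved_res (hω : IsQuasiFree D ω) (hρ : IsDensityMatrix ρ)
    (hDS : D * resShift.toContinuousLinearMap = resShift.toContinuousLinearMap * D)
    (α : ℝ) (j k : Fin d) (m r : ℕ) :
    productState ω ρ (star (evolvedObs α k m) * resObs d ((j.val + (m + r) * d : ℕ) : ℤ))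
      = Complex.I * Real.sin α * ∑ i ∈ Finset.range m, (Real.cos α : ℂ) ^ i *
          symbol D ((k.val : ℤ) - j.val - (i + 1 + r : ℕ) * d) := by
  induction m generalizing r with
  | zero => rw [evolvedObs, productState_sam_res hω]; simp
  | succ m ih =>
    rw [star_evolvedObs_succ, add_mul, productState_add, smul_mul_assoc, smul_mul_assoc,
      productState_smul, productState_smul, productState_res_res hω hρ,
      inner_basisVec_eq_symbol hDS, add_assoc m 1 r, ih, Finset.sum_range_succ', mul_add,
      Finset.mul_sum, Finset.mul_sum, Finset.mul_sum, pow_zero, one_mul]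
    congr 1
    · refine Finset.sum_congr rfl fun i _ => ?_
      rw [show i + 1 + (1 + r) = i + 1 + 1 + r by ring]
      ring
    · congr 2
      push_cast
      ring

/-- The mirror image cross term: exchanging the factors conjugates the coefficient `i sin α` and
reverses the sign of the multiples of `d`. -/
theorem productState_res_evolved (hω : IsQuasiFree D ω) (hρ : IsDensityMatrix ρ)
    (hDS : D * resShift.toContinuousLinearMap = resShift.toContinuousLinearMap * D)
    (α : ℝ) (j k : Fin d) (m r : ℕ) :
    productState ω ρ (star (resObs d ((k.val + (m + r) * d : ℕ) : ℤ)) * evolvedObs α j m)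
      = -(Complex.I * Real.sin α) * ∑ i ∈ Finset.range m, (Real.cos α : ℂ) ^ i *
          symbol D ((k.val : ℤ) - j.val + (i + 1 + r : ℕ) * d) := by
  induction m generalizing r with
  | zero => rw [evolvedObs, productState_res_sam hω]; simp
  | succ m ih =>
    rw [evolvedObs, mul_add, productState_add, mul_smul_comm, mul_smul_comm,
      productState_smul, productState_smul, productState_res_res hω hρ,
      inner_basisVec_eq_symbol hDS, add_assoc m 1 r, ih, Finset.sum_range_succ', mul_add,
      Finset.mul_sum, Finset.mul_sum, Finset.mul_sum, pow_zero, one_mul]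
    congr 1
    · refine Finset.sum_congr rfl fun i _ => ?_
      rw [show i + 1 + (1 + r) = i + 1 + 1 + r by ring]
      ring
    · congr 2
      push_cast
      ring

variable [NeZero d]

theorem oneBodyAt_eq (α : ℝ) (m : ℕ) (j k : Fin d) :
    oneBodyAt α ω ρ (m * d) j k
      = productState ω ρ (star (evolvedObs α k m) * evolvedObs α j m) := by
  refine congrArg (productState ω ρ) (Subtype.ext ?_)
  have h := (carries_evolvedAnnih (α := α) k m).evolve (carries_evolvedAnnih (α := α) j m)
  rw [← coe_evolvedObs, ← coe_evolvedObs] at h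
  refine Eq.trans ?_ h
  rw [samAnnih, samAnnih, tensorOp_star, tensorOp_mul, star_one, one_mul, star_annih]
  rfl

theorem oneBodyAt_zero (hω : IsQuasiFree D ω) (α : ℝ) : oneBodyAt α ω ρ 0 = oneBody ρ := by
  ext j k
  have := oneBodyAt_eq (ω := ω) (ρ := ρ) α 0 j k
  rw [zero_mul] at this
  rw [this]
  exact productState_sam_sam hω k j

/-- Expanding `(cos α A_k - i sin α b_{k+md})* (cos α A_j - i sin α b_{j+md})`, where `A` is the
image after `m` periods, gives four terms. The `A_k* A_j` term is the previous matrix, the two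
reservoir modes give `sin² α σ(k - j)`, and the cross terms give the sums over `σ^{(-u)}` and
`σ^{(u)}`. -/
theorem oneBodyAt_succ (hω : IsQuasiFree D ω) (hρ : IsDensityMatrix ρ)
    (hDS : D * resShift.toContinuousLinearMap = resShift.toContinuousLinearMap * D)
    (α : ℝ) (m : ℕ) :
    oneBodyAt α ω ρ ((m + 1) * d) = ((Real.cos α : ℂ) ^ 2) • oneBodyAt α ω ρ (m * d)
        + ((Real.sin α : ℂ) ^ 2) • driveB d α D m := by
  ext j k
  have h1 := productState_evolved_res hω hρ hDS α j k m 0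
  have h2 := productState_res_evolved hω hρ hDS α j k m 0
  have h3 : driveB d α D m j k = symbol D ((k.val : ℤ) - j.val)
      + ∑ i ∈ Finset.range m, (Real.cos α : ℂ) ^ (i + 1) *
        (symbol D ((k.val : ℤ) - j.val + (i + 1 : ℕ) * d)
          + symbol D ((k.val : ℤ) - j.val - (i + 1 : ℕ) * d)) := by
    rw [driveB, sum_Icc_one_eq_sum_range, Matrix.add_apply, Matrix.sum_apply]
    simp [block, sub_eq_add_neg, -neg_add_rev, neg_mul]
  rw [Matrix.add_apply, Matrix.smul_apply, Matrix.smul_apply, h3, oneBodyAt_eq, oneBodyAt_eq,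
    star_evolvedObs_succ, evolvedObs]
  simp only [add_zero] at h1 h2
  simp only [add_mul, mul_add, smul_mul_assoc, mul_smul_comm, productState_add, productState_smul,
    smul_eq_mul]
  rw [h1, h2, productState_res_res hω hρ, inner_basisVec_eq_symbol hDS]
  have h4 : ((k.val + m * d : ℕ) : ℤ) - ((j.val + m * d : ℕ) : ℤ) = (k.val : ℤ) - j.val := by
    push_cast; ring
  rw [h4]
  simp only [pow_succ', mul_assoc, ← Finset.mul_sum, Finset.sum_add_distrib, pow_zero, mul_one]
  have hI := Complex.I_mul_I
  -- `i² = -1` is used once in the diagonal reservoir term and once in each cross term; the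
  -- coefficient collects these three.
  linear_combination (-(Real.sin α : ℂ) * Real.sin α * (symbol D ((k.val : ℤ) - j.val) +
    Real.cos α * (∑ i ∈ Finset.range m, (Real.cos α : ℂ) ^ i *
      symbol D ((k.val : ℤ) - j.val + (i + 1 : ℕ) * d)) +
    Real.cos α * (∑ i ∈ Finset.range m, (Real.cos α : ℂ) ^ i *
      symbol D ((k.val : ℤ) - j.val - (i + 1 : ℕ) * d)))) * hI

end recursion

/-! ### Solution of the recursion and its limit -/

section scalar

/-- The solution of `F(m+1) = c² F(m) + s² (b + ∑_{u=1}^m c^u β_u)`, where `c² + s² = 1`. -/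
theorem solve_recursion {M : Type*} [AddCommGroup M] [Module ℂ M] {c s : ℂ}
    (hcs : s ^ 2 + c ^ 2 = 1) {F : ℕ → M} {b : M} {β : ℕ → M}
    (hF : ∀ m, F (m + 1) = c ^ 2 • F m + s ^ 2 • (b + ∑ u ∈ Finset.Icc 1 m, c ^ u • β u)) (m : ℕ) :
    F m = c ^ (2 * m) • F 0 + (1 - c ^ (2 * m)) • b
      + ∑ u ∈ Finset.Icc 1 m, (c ^ u - c ^ (2 * m - u)) • β u := by
  have hs : s ^ 2 = 1 - c ^ 2 := eq_sub_of_add_eq hcs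
  induction m with
  | zero => simp
  | succ m ih =>
    -- The summand `u = m` of the solution is always zero. Including it gives solution and drive the
    -- same range, so the new top term can be dropped here.
    have h0 : c ^ (m + 1) - c ^ (2 * (m + 1) - (m + 1)) = 0 := by
      rw [show 2 * (m + 1) - (m + 1) = m + 1 by omega, sub_self]
    rw [hF, ih, Finset.sum_Icc_succ_top (by omega), h0, zero_smul, add_zero]
    have : ∑ u ∈ Finset.Icc 1 m, (c ^ u - c ^ (2 * (m + 1) - u)) • β u
        = c ^ 2 • (∑ u ∈ Finset.Icc 1 m, (c ^ u - c ^ (2 * m - u)) • β u)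
          + s ^ 2 • ∑ u ∈ Finset.Icc 1 m, c ^ u • β u := by
      rw [Finset.smul_sum, Finset.smul_sum, ← Finset.sum_add_distrib]
      refine Finset.sum_congr rfl fun u hu => ?_
      have := Finset.mem_Icc.1 hu
      -- Since `u ≤ m`, the subtraction is not truncated, and the coefficients match: `c² (c^u -
      -- c^(2m-u)) + (1 - c²) c^u = c^u - c^(2m+2-u)`.
      rw [show 2 * (m + 1) - u = 2 * m - u + 2 by omega, hs, pow_add]
      module
    rw [this, show 2 * (m + 1) = 2 * m + 2 by ring, pow_add, hs]
    module

theorem sum_Icc_eq_sum_Ico_of_vanish {M : Type*} [AddCommGroup M] [Module ℂ M] (c : ℂ)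
    (β : ℕ → M) (m : ℕ) :
    ∑ u ∈ Finset.Icc 1 m, (c ^ u - c ^ (2 * m - u)) • β u
      = ∑ u ∈ Finset.Ico 1 m, (c ^ u - c ^ (2 * m - u)) • β u := by
  rcases m with _ | m
  · simp
  · rw [Finset.sum_Icc_succ_top (by omega), show 2 * (m + 1) - (m + 1) = m + 1 by omega, sub_self,
      zero_smul, add_zero]
    rfl

variable {c b : ℂ} {β : ℕ → ℂ} {C : ℝ}

theorem summable_drive (hc : ‖c‖ < 1) (hβ : ∀ u, ‖β u‖ ≤ C) :
    Summable fun u : ℕ => c ^ (u + 1) * β (u + 1) := by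
  refine Summable.of_norm_bounded (g := fun u => ‖c‖ ^ u * C)
    ((summable_geometric_of_lt_one (norm_nonneg _) hc).mul_right C) fun u => ?_
  rw [norm_mul, norm_pow]
  exact mul_le_mul (pow_le_pow_of_le_one (norm_nonneg _) hc.le (Nat.le_succ u)) (hβ _)
    (norm_nonneg _) (by positivity)

theorem tendsto_drive (hc : ‖c‖ < 1) (hβ : ∀ u, ‖β u‖ ≤ C) :
    Filter.Tendsto (fun m : ℕ => b + ∑ u ∈ Finset.Icc 1 m, c ^ u * β u) Filter.atTop
      (nhds (b + ∑' u : ℕ, c ^ (u + 1) * β (u + 1))) := by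
  simp only [sum_Icc_one_eq_sum_range]
  exact tendsto_const_nhds.add (summable_drive hc hβ).hasSum.tendsto_sum_nat

theorem tendsto_solution (hc : ‖c‖ < 1) (hβ : ∀ u, ‖β u‖ ≤ C) (x : ℂ) :
    Filter.Tendsto (fun m : ℕ => c ^ (2 * m) * x + (1 - c ^ (2 * m)) * b
      + ∑ u ∈ Finset.Icc 1 m, (c ^ u - c ^ (2 * m - u)) * β u) Filter.atTop
      (nhds (b + ∑' u : ℕ, c ^ (u + 1) * β (u + 1))) := by
  have h1 : Filter.Tendsto (fun m : ℕ => c ^ (2 * m)) Filter.atTop (nhds 0) :=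
    (tendsto_pow_atTop_nhds_zero_of_norm_lt_one hc).comp
      (Filter.tendsto_atTop_mono (fun m => by omega : ∀ m, m ≤ 2 * m) Filter.tendsto_id)
  -- The part by which the solution's sum differs from the drive. Each of its `m` terms has exponent
  -- at least `m`, so it is at most `m ‖c‖^m C`.
  have h2 : Filter.Tendsto (fun m : ℕ => ∑ u ∈ Finset.Icc 1 m, c ^ (2 * m - u) * β u)
      Filter.atTop (nhds 0) := by
    have h3 := (tendsto_self_mul_const_pow_of_lt_one (norm_nonneg c) hc).mul_const C
    rw [zero_mul] at h3
    refine squeeze_zero_norm (fun m => ?_) h3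
    refine (norm_sum_le_of_le (f := fun u => c ^ (2 * m - u) * β u) _ (n := fun _ => ‖c‖ ^ m * C)
      fun u hu => ?_).trans ?_
    · have := Finset.mem_Icc.1 hu
      rw [norm_mul, norm_pow]
      exact mul_le_mul (pow_le_pow_of_le_one (norm_nonneg _) hc.le (by omega)) (hβ _)
        (norm_nonneg _) (by positivity)
    · simp [mul_assoc]
  -- The solution is the drive plus `c^(2m) (x - b)` minus the sum in `h2`; the last two vanish in
  -- the limit.
  have h := ((tendsto_drive (b := b) hc hβ).add (h1.mul_const (x - b))).sub h2
  rw [zero_mul, add_zero, sub_zero] at h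
  refine h.congr fun m => ?_
  simp only [sub_mul, Finset.sum_sub_distrib]
  ring

end scalar

theorem norm_cos_lt_one {α : ℝ} (hα : ∀ k : ℤ, α ≠ k * Real.pi) : ‖(Real.cos α : ℂ)‖ < 1 := by
  have hs : Real.sin α ≠ 0 := fun h => by
    obtain ⟨k, hk⟩ := Real.sin_eq_zero_iff.1 h
    exact hα k hk.symm
  rw [Complex.norm_real, Real.norm_eq_abs, ← sq_lt_one_iff_abs_lt_one, Real.cos_sq']
  have := pow_pos (abs_pos.2 hs) 2
  rw [sq_abs] at this
  linarith

theorem norm_block_add_block_le (d : ℕ) (D : L2 ℤ →L[ℂ] L2 ℤ) (j k : Fin d) (u : ℕ) :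
    ‖(block d D u + block d D (-u)) j k‖ ≤ ‖D‖ + ‖D‖ :=
  (norm_add_le _ _).trans (add_le_add (norm_symbol_le D _) (norm_symbol_le D _))

end RepeatedInteraction

end

/-! ### The main theorem -/

theorem mainTheorem6 (d : ℕ) [NeZero d] (α : ℝ)
    (D : RepeatedInteraction.L2 ℤ →L[ℂ] RepeatedInteraction.L2 ℤ)
    (hD0 : D.IsPositive) (hD1 : (1 - D).IsPositive)
    (hDS : D * RepeatedInteraction.resShift.toContinuousLinearMap
      = RepeatedInteraction.resShift.toContinuousLinearMap * D)
    (ω : RepeatedInteraction.carAlgebra ℤ →ₗ[ℂ] ℂ) (hω : RepeatedInteraction.IsQuasiFree D ω)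
    (ρ : RepeatedInteraction.Fock (Fin d) →L[ℂ] RepeatedInteraction.Fock (Fin d))
    (hρ : RepeatedInteraction.IsDensityMatrix ρ) :
    (∀ m : ℕ, RepeatedInteraction.oneBodyAt α ω ρ (m * d)
      = ((Real.cos α : ℂ) ^ (2 * m)) • RepeatedInteraction.oneBody ρ
        + (1 - (Real.cos α : ℂ) ^ (2 * m)) • RepeatedInteraction.block d D 0
        + ∑ u ∈ Finset.Ico 1 m, ((Real.cos α : ℂ) ^ u - (Real.cos α : ℂ) ^ (2 * m - u)) •
            (RepeatedInteraction.block d D u + RepeatedInteraction.block d D (-u))) ∧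
    (∀ m : ℕ, RepeatedInteraction.oneBodyAt α ω ρ ((m + 1) * d)
      = ((Real.cos α : ℂ) ^ 2) • RepeatedInteraction.oneBodyAt α ω ρ (m * d)
        + ((Real.sin α : ℂ) ^ 2) • RepeatedInteraction.driveB d α D m) ∧
    ((∀ k : ℤ, α ≠ k * Real.pi) →
      ∃ L : Matrix (Fin d) (Fin d) ℂ,
        Filter.Tendsto (fun m : ℕ => RepeatedInteraction.oneBodyAt α ω ρ (m * d))
          Filter.atTop (nhds L) ∧
        Filter.Tendsto (fun m : ℕ => RepeatedInteraction.driveB d α D m) Filter.atTop (nhds L) ∧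
        HasSum (fun u : ℕ => ((Real.cos α : ℂ) ^ (u + 1)) •
            (RepeatedInteraction.block d D ((u : ℤ) + 1)
              + RepeatedInteraction.block d D (-((u : ℤ) + 1))))
          (L - RepeatedInteraction.block d D 0)) := by
  have hrec := RepeatedInteraction.oneBodyAt_succ hω hρ hDS α
  have hcs : (Real.sin α : ℂ) ^ 2 + (Real.cos α : ℂ) ^ 2 = 1 := by
    exact_mod_cast Real.sin_sq_add_cos_sq α
  have hsol := RepeatedInteraction.solve_recursion hcs
    (F := fun m => RepeatedInteraction.oneBodyAt α ω ρ (m * d))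
    (b := RepeatedInteraction.block d D 0)
    (β := fun u => RepeatedInteraction.block d D u + RepeatedInteraction.block d D (-u)) hrec
  simp only [zero_mul, RepeatedInteraction.oneBodyAt_zero hω] at hsol
  refine ⟨fun m => ?_, hrec, fun hα => ?_⟩
  · rw [← RepeatedInteraction.sum_Icc_eq_sum_Ico_of_vanish]
    exact hsol m
  have hc := RepeatedInteraction.norm_cos_lt_one hα
  have hβ := RepeatedInteraction.norm_block_add_block_le d D
  -- The limit is defined by entrywise series, so the three convergence claims reduce to scalar ones
  -- with the uniform bound `2 ‖D‖` on the entries.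
  refine ⟨RepeatedInteraction.block d D 0 + Matrix.of fun j k =>
    ∑' u : ℕ, (Real.cos α : ℂ) ^ (u + 1) * (RepeatedInteraction.block d D ((u + 1 : ℕ) : ℤ)
      + RepeatedInteraction.block d D (-((u + 1 : ℕ) : ℤ))) j k, ?_, ?_, ?_⟩
  · refine tendsto_pi_nhds.2 fun j => tendsto_pi_nhds.2 fun k => ?_
    refine (RepeatedInteraction.tendsto_solution hc (hβ j k)
      (RepeatedInteraction.oneBody ρ j k)).congr fun m => ?_
    rw [hsol m, Matrix.add_apply, Matrix.add_apply, Matrix.sum_apply]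
    rfl
  · refine tendsto_pi_nhds.2 fun j => tendsto_pi_nhds.2 fun k => ?_
    refine (RepeatedInteraction.tendsto_drive hc (hβ j k)).congr fun m => ?_
    rw [RepeatedInteraction.driveB, Matrix.add_apply, Matrix.sum_apply]
    rfl
  · rw [add_sub_cancel_left]
    -- `HasSum` is unconditional convergence, which for `d × d` matrices is the same as absolute
    -- convergence.
    refine Pi.hasSum.2 fun j => Pi.hasSum.2 fun k => ?_
    have := (RepeatedInteraction.summable_drive hc (hβ j k)).hasSum
    simp only [Nat.cast_succ] at this
    exact this
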